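/- Let $\beta\in(0,\infty)$, let $0\le r\le R$ be integers and let $\vec x=(x_1,\dots,x_R)\in\mathbb C^R$. For $\nu>1$ let $\Theta_\nu$ be the probability law on the open unit disk $\mathbb D$ with density $\frac{\nu-1}{2\pi}(1-|z|^2)^{(\nu-3)/2}$ with respect to planar Lebesgue measure. Let $\alpha_0,\alpha_1,\alpha_2,\dots$ be independent complex random variables with $\alpha_k\sim\Theta_{\beta(k+1)+1}$. Define $\Phi_k,\Phi_k^*$ by the Szegő recursion $$\Phi_{k+1}(z)=z\Phi_k(z)-\bar\alpha_k\Phi_k^*(z),\qquad \Phi_{k+1}^*(z)=\Phi_k^*(z)-\alpha_k z\Phi_k(z),\qquad \Phi_0=\Phi_0^*=1,$$ and, for $x\in\mathbb C$, put $$v_k(x)=e^{-ikx/2}\begin{bmatrix}\Phi_k^*(e^{ix})\\ \Phi_k(e^{ix})\end{bmatrix}\in\mathbb C^2 .$$ Let $G_R=\{1,2\}^R$, and let $G_R^r\subset G_R$ be the set of those $\vec\imath=(i_1,\dots,i_R)$ that have exactly $r$ entries equal to $1$ and $R-r$ entries equal to $2$; let $\chi_R^r$ be the vector of ones in $\ell^2(G_R^r)$.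 Let $\Delta$ and $V=V(\vec x)$ be the operators on $\ell^2(G_R^r)$ with the matrix entries $$\Delta_{\vec\imath\,\vec\jmath}=\begin{cases}1&\text{if }\#\{q:i_q\ne j_q\}=2\text{ and }\sum_q(i_q-j_q)=0,\\0&\text{otherwise,}\end{cases}\qquad V_{\vec\imath\,\vec\jmath}=\begin{cases}\frac{\sqrt{-1}}{2}\sum_q(-1)^{i_q}x_q&\text{if }\vec\imath=\vec\jmath,\\0&\text{otherwise.}\end{cases}$$ There is a unique $C^1$ function $\Psi(\cdot,\vec x):(0,\infty)\to\ell^2(G_R^r)$ such that $$\frac{d}{dt}\Psi(t,\vec x)=\Bigl(\frac{2}{\beta t}\Delta+V\Bigr)\Psi(t,\vec x)\quad(t>0),\qquad t^{-2r(R-r)/\beta}\,\Psi(t,\vec x)=\chi_R^r+O(t)\quad\text{as }t\downarrow0,$$ and for every $\vec\imath\in G_R^r$ the expectations below exist for every $n\ge1$ and $$\lim_{n\to\infty}n^{-2r(R-r)/\beta}\binom Rr\,\mathbb E\bigl\{v_{n-1}(x_1/n)\otimes\cdots\otimes v_{n-1}(x_R/n)\bigr\}_{\vec\imath}=C\,\Psi(1,\vec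 x)_{\vec\imath},\qquad C=\prod_{p=1}^{r}\frac{\Gamma\bigl(\frac2\beta p\bigr)}{\Gamma\bigl(\frac2\beta(R-r+p)\bigr)} .$$ -/

import Mathlib

open MeasureTheory ProbabilityTheory Filter Topology Asymptotics

noncomputable section

namespace CircularBeta

/-- The law `Θ_ν` on the open unit disk (for `ν > 1`): density
`(ν - 1) / (2π) * (1 - |z|²) ^ ((ν - 3) / 2)` with respect to planar Lebesgue measure. -/
def Theta (ν : ℝ) : Measure ℂ :=
  (volume.restrict (Metric.ball (0 : ℂ) 1)).withDensity
    (fun z => ENNReal.ofReal ((ν - 1) / (2 * Real.pi) * (1 - ‖z‖ ^ 2) ^ ((ν - 3) / 2)))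

/-- The pair `(Φ_k(z), Φ_k^*(z))` produced by the Szegő recursion with Verblunsky coefficients
`a 0, a 1, …`, started from `Φ_0 = Φ_0^* = 1`. -/
def szego (a : ℕ → ℂ) (z : ℂ) : ℕ → ℂ × ℂ
  | 0 => (1, 1)
  | k + 1 =>
    (z * (szego a z k).1 - (starRingEnd ℂ) (a k) * (szego a z k).2,
      (szego a z k).2 - a k * z * (szego a z k).1)

/-- The vector `v_k(x) = e^{-ikx/2} (Φ_k^*(e^{ix}), Φ_k(e^{ix}))`.
Its first coordinate (label 1) has index `0 : Fin 2`, its second (label 2) has index `1 : Fin 2`. -/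
def v (a : ℕ → ℂ) (k : ℕ) (x : ℂ) : Fin 2 → ℂ :=
  ![Complex.exp (-(Complex.I * k * x / 2)) * (szego a (Complex.exp (Complex.I * x)) k).2,
    Complex.exp (-(Complex.I * k * x / 2)) * (szego a (Complex.exp (Complex.I * x)) k).1]

/-- The set `G_R = {1,2}^R`; the labels `1`, `2` are represented by `0`, `1` in `Fin 2`. -/
abbrev G (R : ℕ) : Type := Fin R → Fin 2

/-- The set `G_R^r` of those multi-indices with exactly `r` labels `1` (and `R - r` labels `2`). -/
abbrev Gr (R r : ℕ) : Type :=
  {i : G R // (Finset.univ.filter (fun q => i q = 0)).card = r}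

/-- The adjacency matrix `Δ` on `G_R`. -/
def Delta (R : ℕ) : Matrix (G R) (G R) ℂ := fun i j =>
  if (Finset.univ.filter (fun q => i q ≠ j q)).card = 2 ∧
      ∑ q, (((i q : ℕ) : ℤ) - ((j q : ℕ) : ℤ)) = 0 then 1 else 0

/-- The diagonal potential `V(x)` on `G_R`, with entries `(√-1 / 2) ∑ (-1)^(label of i_q) x_q`,
the label of `i_q` being `i_q + 1`. -/
def V {R : ℕ} (x : Fin R → ℂ) : Matrix (G R) (G R) ℂ :=
  Matrix.diagonal (fun i => Complex.I / 2 * ∑ q, (-1 : ℂ) ^ ((i q : ℕ) + 1) * x q)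

/-- The restriction of a matrix on `G_R` to the indices in `G_R^r`. -/
def restrict {R : ℕ} (r : ℕ) (M : Matrix (G R) (G R) ℂ) : Matrix (Gr R r) (Gr R r) ℂ :=
  M.submatrix Subtype.val Subtype.val

/-- The exponent `2 r (R - r) / β`. -/
def expo (β : ℝ) (R r : ℕ) : ℝ := 2 * r * ((R : ℝ) - r) / β

/-- `Ψ` solves, on `(0, ∞)`, the system `Ψ' = (2 / (β t) Δ + V(x)) Ψ` in `ℓ²(G_R^r)` with
`t ^ (-2 r (R - r) / β) Ψ(t) = χ + O(t)` as `t ↓ 0`, where `χ` is the vector of ones.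
(Such a `Ψ` is automatically `C¹` on `(0, ∞)`; its values for `t ≤ 0` play no role.) -/
structure IsSolution (β : ℝ) {R : ℕ} (r : ℕ) (x : Fin R → ℂ) (Ψ : ℝ → Gr R r → ℂ) : Prop where
  ode : ∀ t : ℝ, 0 < t →
    HasDerivAt Ψ
      ((((2 / (β * t) : ℝ) : ℂ) • restrict r (Delta R) + restrict r (V x)).mulVec (Ψ t)) t
  initial : (fun t : ℝ => ((t ^ (-expo β R r) : ℝ) : ℂ) • Ψ t - (fun _ => 1))
    =O[𝓝[>] (0 : ℝ)] (fun t : ℝ => t)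

/-- The constant `C = ∏_{p=1}^r Γ(2p/β) / Γ(2(R-r+p)/β)`. -/
def C (β : ℝ) (R r : ℕ) : ℝ :=
  ∏ p ∈ Finset.Icc 1 r,
    Real.Gamma (2 / β * p) / Real.Gamma (2 / β * ((R : ℝ) - r + p))

/-- The entry with index `i` of `v_k(x_1) ⊗ ⋯ ⊗ v_k(x_R)`. -/
def vTensor (a : ℕ → ℂ) (k : ℕ) {R : ℕ} (x : Fin R → ℂ) (i : G R) : ℂ :=
  ∏ q, v a k (x q) (i q)

end CircularBeta

end

/-! The law `Theta` is rotation invariant, so averaging one Szegő step keeps the span of the indices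
in `Gr R r` invariant. There the averaged step is the diagonal factor `exp (V / n)` followed by the
matrix with entries `diskMoment κ (flips i j)`, where `κ = β (k + 1) / 2`. All row sums of this
matrix equal one number `rowSum κ r (R - r)`, so dividing by it leaves a stochastic matrix.

The scalar part is explicit: Chu–Vandermonde (`rowSum_eq_prod`) makes each row sum a product of
linear ratios, and Euler's limit for Γ gives the power of `n` and the constant `C`
(`tendsto_prod_rowSum`).

The stochastic part is `1 - N / (k + 1) + O(1 / k ^ 2)`, with `N` the graph Laplacian of weight `2 /
β` on the graph of `Δ`. Together with `exp (V / n)` it is a one-step scheme of mesh `1 / n` for `t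
y' = -N y + t V y`, `y 0 = 1`. This is the equation of `y = t ^ (-expo) Ψ`, because `Δ` is the
constant degree `r (R - r)` minus the unweighted Laplacian.

The maximum principle (`le_norm_smul_add_lapl`) excludes resonances at the singular point `t = 0`,
so a power series solves the equation (`exists_regular_solution`). The scheme is stable, with local
error of order `1 / (n (k + 1))`; these errors add up to `O(log n / n)` (`tendsto_scheme`).
Uniqueness is an energy estimate (`eq_zero_of_hasDerivAt_lapl`). -/

noncomputable section

namespace CircularBeta

open scoped Nat

/-! ### Vector-valued power series with an exponential majorant -/

section PowerSeries

variable {E : Type*} [NormedAddCommGroup E] [NormedSpace ℝ E]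

theorem hasSum_pow_mul_exp_bound (A M t : ℝ) :
    HasSum (fun k : ℕ => |t| ^ k * (A * (M ^ k / k !))) (A * Real.exp (M * |t|)) := by
  have h := (NormedSpace.expSeries_div_hasSum_exp (M * |t|)).mul_left A
  rw [← Real.exp_eq_exp_ℝ] at h
  refine h.congr_fun ?_
  intro k
  rw [mul_pow]; ring

theorem norm_pow_smul_le {ψ : ℕ → E} {A M : ℝ} (hψ : ∀ k, ‖ψ k‖ ≤ A * (M ^ k / k !)) (t : ℝ)
    (k : ℕ) : ‖t ^ k • ψ k‖ ≤ |t| ^ k * (A * (M ^ k / k !)) := by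
  rw [norm_smul, norm_pow, Real.norm_eq_abs]
  gcongr
  exact hψ k

theorem summable_pow_smul [CompleteSpace E] {ψ : ℕ → E} {A M : ℝ}
    (hψ : ∀ k, ‖ψ k‖ ≤ A * (M ^ k / k !)) (t : ℝ) : Summable fun k => t ^ k • ψ k :=
  .of_norm_bounded (hasSum_pow_mul_exp_bound A M t).summable (norm_pow_smul_le hψ t)

theorem norm_tsum_pow_smul_le {ψ : ℕ → E} {A M : ℝ}
    (hψ : ∀ k, ‖ψ k‖ ≤ A * (M ^ k / k !)) (t : ℝ) :
    ‖∑' k, t ^ k • ψ k‖ ≤ A * Real.exp (M * |t|) :=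
  tsum_of_norm_bounded (hasSum_pow_mul_exp_bound A M t) (norm_pow_smul_le hψ t)

/-- The majorant keeps its form under differentiation, with `A` replaced by `A * M`, so it can be
differentiated repeatedly. -/
theorem norm_derivCoeff_le {ψ : ℕ → E} {A M : ℝ}
    (hψ : ∀ k, ‖ψ k‖ ≤ A * (M ^ k / k !)) (k : ℕ) :
    ‖((k : ℝ) + 1) • ψ (k + 1)‖ ≤ A * M * (M ^ k / k !) := by
  rw [norm_smul, Real.norm_of_nonneg (by positivity)]
  refine (mul_le_mul_of_nonneg_left (hψ (k + 1)) (by positivity)).trans (le_of_eq ?_)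
  rw [Nat.factorial_succ]
  push_cast
  field_simp
  ring

theorem hasDerivAt_tsum_pow_smul [CompleteSpace E] {ψ : ℕ → E} {A M : ℝ}
    (hψ : ∀ k, ‖ψ k‖ ≤ A * (M ^ k / k !)) (t : ℝ) :
    HasDerivAt (fun t : ℝ => ∑' k, t ^ k • ψ k)
      (∑' k : ℕ, t ^ k • (((k : ℝ) + 1) • ψ (k + 1))) t := by
  set ρ : ℝ := |t| + 1
  have hρ : 0 < ρ := by positivity
  have hu : Summable fun k : ℕ => (k : ℝ) * ρ ^ (k - 1) * ‖ψ k‖ := by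
    rw [← summable_nat_add_iff 1]
    refine .of_nonneg_of_le (fun k => by positivity) (fun k => ?_)
      (hasSum_pow_mul_exp_bound (A * M) M ρ).summable
    have := norm_pow_smul_le (norm_derivCoeff_le hψ) ρ k
    rw [norm_smul, norm_smul, Real.norm_of_nonneg (by positivity),
      Real.norm_of_nonneg (by positivity)] at this
    push_cast
    rw [abs_of_pos hρ] at this ⊢
    linarith
  have key := hasDerivAt_tsum_of_isPreconnected (g := fun k (t : ℝ) => t ^ k • ψ k)
    (g' := fun k t => ((k : ℝ) * t ^ (k - 1)) • ψ k) hu (Metric.isOpen_ball (x := (0 : ℝ)) (ε := ρ))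
    (convex_ball (0 : ℝ) ρ).isPreconnected
    (fun k s _ => (hasDerivAt_pow k s).smul_const (ψ k))
    (fun k s hs => by
      rw [norm_smul, norm_mul, norm_pow, Real.norm_natCast]
      gcongr
      exact (mem_ball_zero_iff.1 hs).le)
    (y₀ := 0) (by simpa using hρ) (summable_pow_smul hψ 0) (y := t)
    (by simp [ρ])
  convert key using 1
  rw [tsum_eq_zero_add' (f := fun k : ℕ => ((k : ℝ) * t ^ (k - 1)) • ψ k)]
  · simp [smul_smul, mul_comm]
  · convert summable_pow_smul (norm_derivCoeff_le hψ) t using 2 with k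
    simp [smul_smul, mul_comm]

end PowerSeries

/-! ### The regular solution at the singular point -/

section Frobenius

variable {E : Type*} [NormedAddCommGroup E] [NormedSpace ℝ E] [FiniteDimensional ℝ E]

/-- By `hN`, `k + 1 + N` is injective, hence invertible in finite dimension, with inverse of norm at
most `1 / (k + 1)`. These factors build up the factorial. -/
theorem exists_frobenius_coeff (N W : E →L[ℝ] E) (e : E)
    (hN : ∀ (c : ℝ) (u : E), 0 ≤ c → c * ‖u‖ ≤ ‖c • u + N u‖) :
    ∃ ψ : ℕ → E, ψ 0 = e ∧ (∀ k : ℕ, ((k : ℝ) + 1) • ψ (k + 1) + N (ψ (k + 1)) = W (ψ k)) ∧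
      ∀ k, ‖ψ k‖ ≤ ‖e‖ * (‖W‖ ^ k / k !) := by
  have hsurj : ∀ (k : ℕ) (z : E), ∃ u, ((k : ℝ) + 1) • u + N u = z := by
    intro k
    let L : E →ₗ[ℝ] E := ((k : ℝ) + 1) • LinearMap.id + (N : E →ₗ[ℝ] E)
    have hL : Function.Injective L := by
      rw [injective_iff_map_eq_zero]
      intro u hu
      have h := hN ((k : ℝ) + 1) u (by positivity)
      have hu' : ((k : ℝ) + 1) • u + N u = 0 := hu
      rw [hu', norm_zero] at h
      have : ‖u‖ ≤ 0 := by
        by_contra hc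
        push Not at hc
        have : 0 < ((k : ℝ) + 1) * ‖u‖ := by positivity
        linarith
      simpa using this
    exact LinearMap.injective_iff_surjective.1 hL
  choose f hf using hsurj
  let ψ : ℕ → E := fun k => Nat.rec e (fun k u => f k (W u)) k
  have hψ : ∀ k : ℕ, ((k : ℝ) + 1) • ψ (k + 1) + N (ψ (k + 1)) = W (ψ k) := fun k => hf k (W (ψ k))
  refine ⟨ψ, rfl, hψ, fun k => ?_⟩
  induction k with
  | zero => simp [ψ]
  | succ k ih =>
    have h := hN ((k : ℝ) + 1) (ψ (k + 1)) (by positivity)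
    rw [hψ k] at h
    have h2 := (h.trans (W.le_opNorm _)).trans (mul_le_mul_of_nonneg_left ih (norm_nonneg W))
    rw [← le_div_iff₀' (by positivity)] at h2
    refine h2.trans (le_of_eq ?_)
    rw [Nat.factorial_succ]
    push_cast
    field_simp
    ring

/-- The regular solution of `t y' = -N y + t W y` with `y 0 = e`, together with the estimates
on `[0, 1]` needed to compare it with a difference scheme. -/
theorem exists_regular_solution (N W : E →L[ℝ] E) (e : E) (hNe : N e = 0)
    (hN : ∀ (c : ℝ) (u : E), 0 ≤ c → c * ‖u‖ ≤ ‖c • u + N u‖) :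
    ∃ (y y' : ℝ → E) (K : ℝ), 0 ≤ K ∧ (∀ t, HasDerivAt y (y' t) t) ∧
      (∀ t, t • y' t + N (y t) = t • W (y t)) ∧
      (∀ t, 0 ≤ t → t ≤ 1 → ‖y t - e‖ ≤ K * t) ∧ (∀ t, 0 ≤ t → t ≤ 1 → ‖y t‖ ≤ K) ∧
      ∀ t h, 0 ≤ t → 0 ≤ h → t + h ≤ 1 → ‖y (t + h) - y t - h • y' t‖ ≤ K * h ^ 2 := by
  obtain ⟨ψ, hψ0, hψ, hb⟩ := exists_frobenius_coeff N W e hN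
  have hb1 := norm_derivCoeff_le hb
  have hb2 := norm_derivCoeff_le hb1
  set ψ1 : ℕ → E := fun k => ((k : ℝ) + 1) • ψ (k + 1) with hψ1
  set ψ2 : ℕ → E := fun k => ((k : ℝ) + 1) • ψ1 (k + 1) with hψ2
  set y : ℝ → E := fun t => ∑' k, t ^ k • ψ k with hy
  set y1 : ℝ → E := fun t => ∑' k, t ^ k • ψ1 k with hy1
  set y2 : ℝ → E := fun t => ∑' k, t ^ k • ψ2 k with hy2
  have hd : ∀ t, HasDerivAt y (y1 t) t := hasDerivAt_tsum_pow_smul hb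
  have hd1 : ∀ t, HasDerivAt y1 (y2 t) t := hasDerivAt_tsum_pow_smul hb1
  set B := Real.exp ‖W‖
  have hB : 0 ≤ B := (Real.exp_pos _).le
  have hexp : ∀ (A t : ℝ), 0 ≤ A → 0 ≤ t → t ≤ 1 → A * Real.exp (‖W‖ * |t|) ≤ A * B := by
    intro A t hA h0 h1
    refine mul_le_mul_of_nonneg_left (Real.exp_le_exp.2 ?_) hA
    rw [abs_of_nonneg h0]
    exact mul_le_of_le_one_right (norm_nonneg _) h1
  set K0 := ‖e‖ * B
  set K1 := ‖e‖ * ‖W‖ * B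
  set K2 := ‖e‖ * ‖W‖ * ‖W‖ * B
  have h0 : ∀ t, 0 ≤ t → t ≤ 1 → ‖y t‖ ≤ K0 := fun t ht ht' =>
    (norm_tsum_pow_smul_le hb t).trans (hexp _ t (by positivity) ht ht')
  have h1 : ∀ t, 0 ≤ t → t ≤ 1 → ‖y1 t‖ ≤ K1 := fun t ht ht' =>
    (norm_tsum_pow_smul_le hb1 t).trans (hexp _ t (by positivity) ht ht')
  have h2 : ∀ t, 0 ≤ t → t ≤ 1 → ‖y2 t‖ ≤ K2 := fun t ht ht' =>
    (norm_tsum_pow_smul_le hb2 t).trans (hexp _ t (by positivity) ht ht')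
  have hy0 : y 0 = e := by
    rw [hy, ← hψ0]
    simp only
    rw [tsum_eq_single 0]
    · simp
    · intro k hk; simp [hk]
  have hK0 : 0 ≤ K0 := by positivity
  have hK1 : 0 ≤ K1 := by positivity
  have hK2 : 0 ≤ K2 := by positivity
  refine ⟨y, y1, K0 + K1 + K2, by positivity, hd, ?_, ?_, ?_, ?_⟩
  · intro t
    have s0 := summable_pow_smul hb t
    have s1 := summable_pow_smul hb1 t
    have sN : Summable fun k => t ^ k • N (ψ (k + 1)) := by
      refine .of_norm_bounded ((hasSum_pow_mul_exp_bound (‖N‖ * (‖e‖ * ‖W‖)) ‖W‖ t).summable)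
        (norm_pow_smul_le (fun k => ?_) t)
      rw [mul_assoc]
      refine (N.le_opNorm _).trans (mul_le_mul_of_nonneg_left ?_ (norm_nonneg _))
      refine le_trans ?_ (hb1 k)
      rw [norm_smul, Real.norm_of_nonneg (by positivity)]
      exact le_mul_of_one_le_left (norm_nonneg _) (by linarith [k.cast_nonneg (α := ℝ)])
    -- The constant term of the series is killed by `N e = 0`, so a factor `t` comes out.
    have e1 : N (y t) = t • ∑' k, t ^ k • N (ψ (k + 1)) := by
      rw [hy]
      simp only
      rw [N.map_tsum s0, (N.summable s0).tsum_eq_zero_add, ← sN.tsum_const_smul]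
      simp only [map_smul, hψ0, hNe, smul_zero, zero_add, smul_smul, pow_succ']
    rw [e1, hy1, ← smul_add, hy]
    simp only
    rw [W.map_tsum s0, ← s1.tsum_add sN]
    congr 2
    funext k
    rw [← smul_add, map_smul, ← hψ k]
  · intro t ht ht'
    rw [← hy0]
    have := Convex.norm_image_sub_le_of_norm_hasDerivWithin_le (s := Set.Icc (0 : ℝ) 1) (C := K1)
      (fun s _ => (hd s).hasDerivWithinAt) (fun s hs => h1 s hs.1 hs.2) (convex_Icc 0 1)
      (x := 0) (y := t) (by simp) ⟨ht, ht'⟩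
    rw [sub_zero, Real.norm_of_nonneg ht] at this
    refine this.trans (mul_le_mul_of_nonneg_right ?_ ht)
    linarith
  · intro t ht ht'
    linarith [h0 t ht ht']
  · intro t h ht hh hth
    have hb' : ∀ s ∈ Set.Icc t (t + h), ‖y1 s - y1 t‖ ≤ K2 * h := by
      intro s hs
      have := Convex.norm_image_sub_le_of_norm_hasDerivWithin_le (s := Set.Icc (0 : ℝ) 1) (C := K2)
        (fun s _ => (hd1 s).hasDerivWithinAt) (fun s hs => h2 s hs.1 hs.2) (convex_Icc 0 1)
        (x := t) (y := s) ⟨ht, by linarith⟩ ⟨ht.trans hs.1, hs.2.trans hth⟩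
      rw [Real.norm_of_nonneg (by linarith [hs.1])] at this
      exact this.trans (mul_le_mul_of_nonneg_left (by linarith [hs.2]) hK2)
    -- Removing the tangent line turns the mean value inequality into a second-order Taylor bound.
    have hz : ∀ s, HasDerivAt (fun s => y s - s • y1 t) (y1 s - y1 t) s := by
      intro s
      simpa using (hd s).fun_sub ((hasDerivAt_id' s).smul_const (y1 t))
    have := Convex.norm_image_sub_le_of_norm_hasDerivWithin_le (s := Set.Icc t (t + h))
      (fun s _ => (hz s).hasDerivWithinAt) hb' (convex_Icc t (t + h))
      (x := t) (y := t + h) ⟨le_rfl, by linarith⟩ ⟨by linarith, le_rfl⟩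
    rw [add_sub_cancel_left, Real.norm_of_nonneg hh] at this
    have e2 : y (t + h) - (t + h) • y1 t - (y t - t • y1 t) = y (t + h) - y t - h • y1 t := by
      rw [add_smul]; abel
    rw [e2] at this
    refine this.trans ?_
    nlinarith [sq_nonneg h]

end Frobenius

/-! ### Convergence of the one-step scheme -/

section Scheme

variable {E : Type*} [NormedAddCommGroup E] [NormedSpace ℝ E]

/-- One-step consistency error of the scheme `u ↦ S (D u)` for `t y' = -N y + t W y` at the node
`t = a * h`. -/
theorem norm_scheme_step_le {N W S D : E →L[ℝ] E} {e : E} (hNe : N e = 0) {y y' : ℝ → E}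
    {K L : ℝ} (hK : 0 ≤ K) (hL : 0 ≤ L)
    (hode : ∀ t, t • y' t + N (y t) = t • W (y t))
    (hye : ∀ t, 0 ≤ t → t ≤ 1 → ‖y t - e‖ ≤ K * t) (hyb : ∀ t, 0 ≤ t → t ≤ 1 → ‖y t‖ ≤ K)
    (hyt : ∀ t h, 0 ≤ t → 0 ≤ h → t + h ≤ 1 → ‖y (t + h) - y t - h • y' t‖ ≤ K * h ^ 2)
    {a h : ℝ} (ha : 1 ≤ a) (hh : 0 < h) (hah : a * h + h ≤ 1)
    (hS : ∀ u, ‖S u‖ ≤ ‖u‖) (hSe : S e = e)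
    (hSN : ∀ u, ‖S u - u + a⁻¹ • N u‖ ≤ L / a ^ 2 * ‖u‖)
    (hD : ∀ u, ‖D u - u - h • W u‖ ≤ L * h ^ 2 * ‖u‖) :
    ‖S (D (y (a * h))) - y (a * h + h)‖ ≤
      (2 * L * K + (L + ‖N‖) * ‖W‖ * K + K) * (h / a) := by
  have ha0 : 0 < a := by linarith
  have ht0 : 0 ≤ a * h := by positivity
  have ht1 : a * h ≤ 1 := by linarith
  have hha : h ≤ a⁻¹ := by
    rw [le_inv_comm₀ hh ha0, ← one_div, le_div_iff₀ hh]; linarith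
  have hh2 : h ^ 2 ≤ h / a := by
    rw [pow_two, div_eq_mul_inv]; gcongr
  have ha2 : 1 / a ^ 2 ≤ 1 / a := by
    apply one_div_le_one_div_of_le ha0; nlinarith
  set u := y (a * h) with hu
  have hy' : h • y' (a * h) = h • W u - a⁻¹ • N u := by
    have h1 := congrArg (fun z => a⁻¹ • z) (hode (a * h))
    simp only [smul_add, smul_smul, inv_mul_cancel_left₀ ha0.ne'] at h1
    rw [← hu] at h1
    rw [← h1]; abel
  have e1 : ‖S (D u - u - h • W u)‖ ≤ L * K * (h / a) := by
    calc _ ≤ _ := hS _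
      _ ≤ _ := hD _
      _ ≤ L * (h / a) * K := by gcongr; exact hyb _ ht0 ht1
      _ = _ := by ring
  have e2 : ‖h • (S (W u) - W u)‖ ≤ (L + ‖N‖) * ‖W‖ * K * (h / a) := by
    have hWu : ‖W u‖ ≤ ‖W‖ * K := (W.le_opNorm _).trans (by gcongr; exact hyb _ ht0 ht1)
    have hNW : ‖a⁻¹ • N (W u)‖ ≤ a⁻¹ * (‖N‖ * (‖W‖ * K)) := by
      rw [norm_smul, Real.norm_of_nonneg (by positivity)]
      gcongr
      exact (N.le_opNorm _).trans (by gcongr)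
    have h1 : ‖S (W u) - W u + a⁻¹ • N (W u)‖ ≤ L / a * (‖W‖ * K) := by
      refine (hSN _).trans ?_
      rw [div_eq_mul_one_div L, div_eq_mul_one_div L a]
      gcongr
    rw [norm_smul, Real.norm_of_nonneg hh.le]
    have h2 : ‖S (W u) - W u‖ ≤ L / a * (‖W‖ * K) + a⁻¹ * (‖N‖ * (‖W‖ * K)) := by
      have := norm_sub_le (S (W u) - W u + a⁻¹ • N (W u)) (a⁻¹ • N (W u))
      rw [add_sub_cancel_right] at this
      linarith
    refine (mul_le_mul_of_nonneg_left h2 hh.le).trans (le_of_eq ?_)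
    field_simp
  -- Since `S e = e` and `N e = 0`, only `u - e` matters. Its norm is at most `K * (a * h)`, which
  -- turns `L / a ^ 2` into a multiple of `h / a`.
  have e3 : ‖S u - u + a⁻¹ • N u‖ ≤ L * K * (h / a) := by
    have h1 := hSN (u - e)
    rw [map_sub, map_sub, hSe, hNe, sub_zero] at h1
    rw [show S u - e - (u - e) + a⁻¹ • N u = S u - u + a⁻¹ • N u by abel] at h1
    refine h1.trans ((mul_le_mul_of_nonneg_left (hye _ ht0 ht1) (by positivity)).trans
      (le_of_eq ?_))
    field_simp
  have e4 : ‖y (a * h + h) - u - h • y' (a * h)‖ ≤ K * (h / a) :=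
    (hyt _ _ ht0 hh.le hah).trans (by gcongr)
  have key : S (D u) - y (a * h + h) = S (D u - u - h • W u) + h • (S (W u) - W u) +
      (S u - u + a⁻¹ • N u) - (y (a * h + h) - u - h • y' (a * h)) := by
    rw [hy']
    simp only [map_sub, map_smul, smul_sub]
    abel
  rw [key]
  refine (norm_sub_le _ _).trans ?_
  have := norm_add₃_le (a := S (D u - u - h • W u)) (b := h • (S (W u) - W u))
    (c := S u - u + a⁻¹ • N u)
  nlinarith

/-- Stability: `S k` is a contraction and `D n` has norm at most `1 + M / n`, so errors grow at most
by `exp M`. Consistency: the local errors `(1 / n) / (k + 1)` sum to a Cesàro mean of a null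
sequence. -/
theorem tendsto_scheme {N W : E →L[ℝ] E} {e : E} (hNe : N e = 0) {y y' : ℝ → E}
    {K L : ℝ} (hK : 0 ≤ K) (hL : 0 ≤ L)
    (hode : ∀ t, t • y' t + N (y t) = t • W (y t))
    (hye : ∀ t, 0 ≤ t → t ≤ 1 → ‖y t - e‖ ≤ K * t) (hyb : ∀ t, 0 ≤ t → t ≤ 1 → ‖y t‖ ≤ K)
    (hyt : ∀ t h, 0 ≤ t → 0 ≤ h → t + h ≤ 1 → ‖y (t + h) - y t - h • y' t‖ ≤ K * h ^ 2)
    (S D : ℕ → E →L[ℝ] E)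
    (hS : ∀ k u, ‖S k u‖ ≤ ‖u‖) (hSe : ∀ k, S k e = e)
    (hSN : ∀ (k : ℕ) u, ‖S k u - u + ((k : ℝ) + 1)⁻¹ • N u‖ ≤ L / ((k : ℝ) + 1) ^ 2 * ‖u‖)
    (hD : ∀ n : ℕ, 1 ≤ n → ∀ u,
      ‖D n u - u - (n : ℝ)⁻¹ • W u‖ ≤ L * ((n : ℝ)⁻¹) ^ 2 * ‖u‖)
    (w : ℕ → ℕ → E) (hw0 : ∀ n, w n 0 = e)
    (hw : ∀ n, 1 ≤ n → ∀ k, w n (k + 1) = S k (D n (w n k))) :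
    Tendsto (fun n => w n (n - 1)) atTop (𝓝 (y 1)) := by
  -- The factor 2 pays for `1 / (k + 1) ≤ 2 / (k + 2)`; the last `K` pays for the initial error.
  set A := 2 * (2 * L * K + (L + ‖N‖) * ‖W‖ * K + K) + K with hA
  set M := ‖W‖ + L with hM
  have hM0 : 0 ≤ M := by positivity
  have hA0 : 0 ≤ A := by positivity
  -- The node of `w n k` is `(k + 1) / n`: this matches the expansion of `S k` in `1 / (k + 1)` and
  -- places `w n (n - 1)` at time 1.
  have main : ∀ n : ℕ, 1 ≤ n → ∀ k : ℕ, k + 1 ≤ n →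
      ‖w n k - y (((k : ℝ) + 1) * (n : ℝ)⁻¹)‖ ≤ (1 + M * (n : ℝ)⁻¹) ^ k *
        (A * ((n : ℝ)⁻¹ * ∑ j ∈ Finset.range (k + 1), ((j : ℝ) + 1)⁻¹)) := by
    intro n hn
    have hn0 : (0 : ℝ) < n := by exact_mod_cast hn
    set h := (n : ℝ)⁻¹ with hh
    have hh0 : 0 < h := by positivity
    have hnh : (n : ℝ) * h = 1 := mul_inv_cancel₀ hn0.ne'
    have hh1 : h ≤ 1 := by
      rw [hh]; exact inv_le_one_of_one_le₀ (by exact_mod_cast hn)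
    have hDb : ∀ u, ‖D n u‖ ≤ (1 + M * h) * ‖u‖ := by
      intro u
      have h1 := hD n hn u
      have h2 : ‖h • W u‖ ≤ h * (‖W‖ * ‖u‖) := by
        rw [norm_smul, Real.norm_of_nonneg hh0.le]
        gcongr
        exact W.le_opNorm u
      have h3 := norm_add₃_le (a := D n u - u - h • W u) (b := u) (c := h • W u)
      rw [show D n u - u - h • W u + u + h • W u = D n u by abel] at h3
      have h4 : L * h ^ 2 * ‖u‖ ≤ L * h * ‖u‖ := by
        gcongr
        nlinarith
      rw [hM]
      nlinarith
    intro k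
    induction k with
    | zero =>
      intro _
      rw [hw0, norm_sub_rev]
      have := hye h hh0.le hh1
      simp only [CharP.cast_eq_zero, zero_add, one_mul, pow_zero, Finset.range_one,
        Finset.sum_singleton, inv_one, mul_one]
      refine this.trans ?_
      gcongr
      have : 0 ≤ 2 * (2 * L * K + (L + ‖N‖) * ‖W‖ * K + K) := by positivity
      linarith
    | succ k ih =>
      intro hk
      have hk' : ((k : ℝ) + 1) * h + h ≤ 1 := by
        have : ((k + 1 + 1 : ℕ) : ℝ) ≤ n := by exact_mod_cast hk
        push_cast at this
        nlinarith
      have hstep := norm_scheme_step_le hNe hK hL hode hye hyb hyt (a := (k : ℝ) + 1) (h := h)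
        (by linarith [k.cast_nonneg (α := ℝ)]) hh0 hk' (hS k) (hSe k) (hSN k) (hD n hn)
      have ih' := ih (by omega)
      rw [hw n hn]
      push_cast
      rw [show ((k : ℝ) + 1 + 1) * h = ((k : ℝ) + 1) * h + h by ring]
      set t := ((k : ℝ) + 1) * h
      have h1 : ‖S k (D n (w n k)) - S k (D n (y t))‖ ≤ (1 + M * h) * ‖w n k - y t‖ := by
        rw [← map_sub, ← map_sub]
        exact (hS _ _).trans (hDb _)
      have h2 := norm_sub_le_norm_sub_add_norm_sub (S k (D n (w n k))) (S k (D n (y t)))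
        (y (t + h))
      have h3 : (2 * L * K + (L + ‖N‖) * ‖W‖ * K + K) * (h / ((k : ℝ) + 1)) ≤
          A * (h * ((k : ℝ) + 1 + 1)⁻¹) := by
        have : h / ((k : ℝ) + 1) ≤ 2 * (h * ((k : ℝ) + 1 + 1)⁻¹) := by
          have hk0 := k.cast_nonneg (α := ℝ)
          rw [div_eq_mul_inv, mul_left_comm]
          gcongr
          rw [← div_eq_mul_inv, inv_eq_one_div, div_le_div_iff₀ (by positivity) (by positivity)]
          linarith
        have hB : 0 ≤ 2 * L * K + (L + ‖N‖) * ‖W‖ * K + K := by positivity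
        have hz : 0 ≤ h * ((k : ℝ) + 1 + 1)⁻¹ := by positivity
        refine (mul_le_mul_of_nonneg_left this hB).trans ?_
        rw [hA]
        nlinarith
      have h4 : (1 : ℝ) ≤ (1 + M * h) ^ (k + 1) := one_le_pow₀ (by nlinarith [mul_nonneg hM0 hh0.le])
      rw [Finset.sum_range_succ]
      push_cast
      have h5 : A * (h * ((k : ℝ) + 1 + 1)⁻¹) ≤
          (1 + M * h) ^ (k + 1) * (A * (h * ((k : ℝ) + 1 + 1)⁻¹)) :=
        le_mul_of_one_le_left (by positivity) h4
      have h6 : (1 + M * h) * ‖w n k - y t‖ ≤ (1 + M * h) * ((1 + M * h) ^ k *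
          (A * (h * ∑ j ∈ Finset.range (k + 1), ((j : ℝ) + 1)⁻¹))) := by gcongr
      calc _ ≤ (1 + M * h) * ((1 + M * h) ^ k *
          (A * (h * ∑ j ∈ Finset.range (k + 1), ((j : ℝ) + 1)⁻¹))) +
          (1 + M * h) ^ (k + 1) * (A * (h * ((k : ℝ) + 1 + 1)⁻¹)) := by linarith
        _ = _ := by ring
  have hces : Tendsto (fun n : ℕ => (n : ℝ)⁻¹ * ∑ j ∈ Finset.range n, ((j : ℝ) + 1)⁻¹) atTop
      (𝓝 0) := by
    have h0 : Tendsto (fun j : ℕ => ((j : ℝ) + 1)⁻¹) atTop (𝓝 0) := by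
      simpa [one_div] using tendsto_one_div_add_atTop_nhds_zero_nat (𝕜 := ℝ)
    exact h0.cesaro
  have hlim := (hces.const_mul A).const_mul (Real.exp M)
  rw [mul_zero, mul_zero] at hlim
  rw [tendsto_iff_norm_sub_tendsto_zero]
  refine squeeze_zero' (Eventually.of_forall fun _ => norm_nonneg _) ?_ hlim
  filter_upwards [eventually_ge_atTop 1] with n hn
  have hn0 : (0 : ℝ) < n := by exact_mod_cast hn
  have h1 := main n hn (n - 1) (by omega)
  rw [Nat.sub_add_cancel hn, Nat.cast_sub hn, Nat.cast_one, sub_add_cancel,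
    mul_inv_cancel₀ hn0.ne'] at h1
  refine h1.trans ?_
  gcongr
  calc (1 + M * (n : ℝ)⁻¹) ^ (n - 1) ≤ (Real.exp (M * (n : ℝ)⁻¹)) ^ (n - 1) := by
        gcongr
        linarith [Real.add_one_le_exp (M * (n : ℝ)⁻¹)]
    _ ≤ (Real.exp (M * (n : ℝ)⁻¹)) ^ n :=
        pow_le_pow_right₀ (Real.one_le_exp (by positivity)) (by omega)
    _ = Real.exp M := by
        rw [← Real.exp_nat_mul]; congr 1; field_simp

end Scheme

/-! ### Moments of the disk law -/

section Moments

/-- The moment `E |α| ^ (2 m)` for `α` distributed as `Θ_(2 κ + 1)`. -/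
def diskMoment (κ : ℝ) (m : ℕ) : ℝ := m ! / ∏ l ∈ Finset.range m, (κ + 1 + l)

theorem diskMoment_zero (κ : ℝ) : diskMoment κ 0 = 1 := by simp [diskMoment]

theorem diskMoment_succ (κ : ℝ) (m : ℕ) :
    diskMoment κ (m + 1) = (m + 1) / (κ + 1 + m) * diskMoment κ m := by
  rw [diskMoment, diskMoment, Finset.prod_range_succ, Nat.factorial_succ]
  push_cast
  rw [div_mul_div_comm]
  ring_nf

theorem hasDerivAt_pow_mul_rpow {κ : ℝ} (m : ℕ) {y : ℝ} (hy : y ∈ Set.Ioo (0 : ℝ) 1) :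
    HasDerivAt (fun y : ℝ => y ^ m * (1 - y ^ 2) ^ κ)
      (m * y ^ (m - 1) * (1 - y ^ 2) ^ κ - 2 * κ * y ^ (m + 1) * (1 - y ^ 2) ^ (κ - 1)) y := by
  have h1 : 0 < 1 - y ^ 2 := by nlinarith [hy.1, hy.2]
  have h := (hasDerivAt_pow m y).fun_mul
    ((((hasDerivAt_pow 2 y).const_sub 1)).rpow_const (p := κ) (Or.inl h1.ne'))
  refine HasDerivAt.congr_deriv h ?_
  push_cast
  simp only [pow_one]
  ring

/-- For `κ < 1` the integrand blows up at 1. For `m = 0` it is the nonnegative derivative of the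
continuous function `-(1 - y ^ 2) ^ κ`; the factor `y ^ m` is harmless. -/
theorem intervalIntegrable_radial {κ : ℝ} (hκ : 0 < κ) (m : ℕ) :
    IntervalIntegrable (fun y : ℝ => 2 * κ * y ^ (m + 1) * (1 - y ^ 2) ^ (κ - 1)) volume 0 1 := by
  have h0 : IntervalIntegrable (fun y : ℝ => -(0 - 2 * κ * y * (1 - y ^ 2) ^ (κ - 1)))
      volume 0 1 := by
    refine intervalIntegral.intervalIntegrable_deriv_of_nonneg
      (g := fun y : ℝ => -((1 - y ^ 2) ^ κ)) ?_ ?_ ?_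
    · exact ((continuous_const.sub (continuous_pow 2)).rpow_const
        fun _ => Or.inr hκ.le).neg.continuousOn
    · intro y hy
      rw [min_eq_left zero_le_one, max_eq_right zero_le_one] at hy
      simpa using (hasDerivAt_pow_mul_rpow (κ := κ) 0 hy).fun_neg
    · intro y hy
      rw [min_eq_left zero_le_one, max_eq_right zero_le_one] at hy
      have h1 : 0 < 1 - y ^ 2 := by nlinarith [hy.1, hy.2]
      have := Real.rpow_nonneg h1.le (κ - 1)
      have := hy.1
      simp only [zero_sub, neg_neg]
      positivity
  have h1 := h0.continuousOn_mul (g := fun y : ℝ => y ^ m) (continuous_pow m).continuousOn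
  refine h1.congr ?_
  intro y _
  simp only
  ring

theorem integral_radial {κ : ℝ} (hκ : 0 < κ) (m : ℕ) :
    ∫ y in (0 : ℝ)..1, 2 * κ * y ^ (2 * m + 1) * (1 - y ^ 2) ^ (κ - 1) = diskMoment κ m := by
  have hcont : ∀ m : ℕ, ContinuousOn (fun y : ℝ => y ^ m * (1 - y ^ 2) ^ κ) (Set.Icc 0 1) :=
    fun m => ((continuous_pow m).mul ((continuous_const.sub (continuous_pow 2)).rpow_const
      fun _ => Or.inr hκ.le)).continuousOn
  induction m with
  | zero =>
    have hint := intervalIntegrable_radial hκ 0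
    have h := intervalIntegral.integral_eq_sub_of_hasDerivAt_of_le zero_le_one (hcont 0)
      (fun y hy => hasDerivAt_pow_mul_rpow 0 hy) (hint.neg.congr fun y _ => by simp)
    simp only [CharP.cast_eq_zero, zero_mul, zero_sub, intervalIntegral.integral_neg] at h
    simp only [mul_zero, diskMoment_zero]
    have h2 : (0 : ℝ) ^ κ = 0 := Real.zero_rpow hκ.ne'
    norm_num [h2] at h ⊢
    linarith
  | succ m ih =>
    have hi0 := intervalIntegrable_radial hκ (2 * m)
    have hi1 := intervalIntegrable_radial hκ (2 * (m + 1))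
    -- This primitive vanishes at both endpoints, so integrating its derivative yields the moment
    -- recursion.
    have hd : ∀ y ∈ Set.Ioo (0 : ℝ) 1, HasDerivAt (fun y : ℝ => y ^ (2 * (m + 1)) * (1 - y ^ 2) ^ κ)
        (((m : ℝ) + 1) / κ * (2 * κ * y ^ (2 * m + 1) * (1 - y ^ 2) ^ (κ - 1)) -
          (((m : ℝ) + 1) / κ + 1) *
            (2 * κ * y ^ (2 * (m + 1) + 1) * (1 - y ^ 2) ^ (κ - 1))) y := by
      intro y hy
      have h1 : 0 < 1 - y ^ 2 := by nlinarith [hy.1, hy.2]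
      convert hasDerivAt_pow_mul_rpow (2 * (m + 1)) hy using 1
      have : (1 - y ^ 2) ^ κ = (1 - y ^ 2) ^ (κ - 1) * (1 - y ^ 2) := by
        rw [← Real.rpow_add_one h1.ne', sub_add_cancel]
      rw [this]
      have e : 2 * (m + 1) - 1 = 2 * m + 1 := by omega
      rw [e]
      push_cast
      field_simp
      ring
    have h := intervalIntegral.integral_eq_sub_of_hasDerivAt_of_le zero_le_one
      (hcont (2 * (m + 1))) hd ((hi0.const_mul _).sub (hi1.const_mul _))
    rw [intervalIntegral.integral_sub (hi0.const_mul _) (hi1.const_mul _),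
      intervalIntegral.integral_const_mul, intervalIntegral.integral_const_mul, ih] at h
    have h2 : (0 : ℝ) ^ κ = 0 := Real.zero_rpow hκ.ne'
    have h3 : (0 : ℝ) ^ (2 * (m + 1)) = 0 := by simp
    rw [h3] at h
    norm_num [h2] at h
    rw [diskMoment_succ]
    have : 0 < κ + 1 + m := by positivity
    field_simp at h ⊢
    linarith

theorem Theta_ae_norm_lt_one (ν : ℝ) : ∀ᵐ z ∂Theta ν, ‖z‖ < 1 := by
  refine (withDensity_absolutelyContinuous _ _).ae_le ?_
  filter_upwards [ae_restrict_mem Metric.isOpen_ball.measurableSet] with z hz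
  simpa using hz

/-- The radial profile of the density of `Θ_(2 κ + 1)`. -/
def radialDensity (κ : ℝ) (s : ℝ) : ℝ :=
  (Set.Iio 1).indicator (fun s => κ / Real.pi * (1 - s ^ 2) ^ (κ - 1)) s

theorem integral_Theta {κ : ℝ} (hκ : 0 < κ) (f : ℂ → ℂ) :
    ∫ z, f z ∂Theta (2 * κ + 1) = ∫ z, radialDensity κ ‖z‖ • f z := by
  rw [Theta, integral_withDensity_eq_integral_toReal_smul (by fun_prop)
    (Eventually.of_forall fun _ => ENNReal.ofReal_lt_top),
    ← integral_indicator Metric.isOpen_ball.measurableSet]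
  congr 1
  funext z
  by_cases hz : ‖z‖ < 1
  · have h1 : 0 < 1 - ‖z‖ ^ 2 := by nlinarith [norm_nonneg z]
    rw [Set.indicator_of_mem (by simpa using hz), radialDensity,
      Set.indicator_of_mem (by simpa using hz), ENNReal.toReal_ofReal]
    · congr 1
      rw [show (2 * κ + 1 - 3) / 2 = κ - 1 by ring]
      congr 1
      field_simp
      ring
    · have := Real.rpow_nonneg h1.le ((2 * κ + 1 - 3) / 2)
      rw [add_sub_cancel_right]
      positivity
  · rw [Set.indicator_of_notMem (by simpa using hz), radialDensity,
      Set.indicator_of_notMem (by simpa using hz), zero_smul]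

theorem integral_radialDensity {κ : ℝ} (hκ : 0 < κ) (m : ℕ) :
    ∫ z : ℂ, radialDensity κ ‖z‖ * ‖z‖ ^ (2 * m) = diskMoment κ m := by
  rw [integral_fun_norm_addHaar volume fun s => radialDensity κ s * s ^ (2 * m)]
  have hpi : volume.real (Metric.ball (0 : ℂ) 1) = Real.pi := by
    simp [Measure.real, Complex.volume_ball]
  rw [hpi, Complex.finrank_real_complex, ← integral_radial hκ,
    intervalIntegral.integral_of_le zero_le_one, integral_Ioc_eq_integral_Ioo,
    ← integral_indicator measurableSet_Ioo, ← integral_indicator measurableSet_Ioi,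
    nsmul_eq_mul, smul_eq_mul, ← integral_const_mul, ← integral_const_mul]
  congr 1
  funext s
  by_cases h0 : 0 < s
  · by_cases h1 : s < 1
    · rw [Set.indicator_of_mem (show s ∈ Set.Ioi 0 from h0), radialDensity,
        Set.indicator_of_mem (show s ∈ Set.Iio 1 from h1),
        Set.indicator_of_mem (show s ∈ Set.Ioo 0 1 from ⟨h0, h1⟩)]
      have := Real.pi_pos
      simp only [smul_eq_mul]
      push_cast
      field_simp
      ring
    · rw [Set.indicator_of_mem (show s ∈ Set.Ioi 0 from h0), radialDensity,
        Set.indicator_of_notMem (show s ∉ Set.Iio 1 from h1),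
        Set.indicator_of_notMem (show s ∉ Set.Ioo 0 1 from fun h => h1 h.2)]
      simp
  · rw [Set.indicator_of_notMem (show s ∉ Set.Ioi 0 from h0),
      Set.indicator_of_notMem (show s ∉ Set.Ioo 0 1 from fun h => h0 h.1)]
    simp

/-- The angle `π / (a - b)` gives the value `-1`. -/
theorem exists_circle_pow_mul_ne_one {a b : ℕ} (hab : a ≠ b) :
    ∃ c : Circle, (c : ℂ) ^ a * (starRingEnd ℂ) (c : ℂ) ^ b ≠ 1 := by
  set θ : ℝ := Real.pi / ((a : ℝ) - b) with hθ
  have hab' : (a : ℝ) - b ≠ 0 := sub_ne_zero.2 (by exact_mod_cast hab)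
  refine ⟨Circle.exp θ, ?_⟩
  rw [Circle.coe_exp, ← Complex.exp_conj, ← Complex.exp_nat_mul, ← Complex.exp_nat_mul,
    ← Complex.exp_add]
  have e : (a : ℂ) * (θ * Complex.I) + b * (starRingEnd ℂ) (θ * Complex.I) =
      Real.pi * Complex.I := by
    rw [map_mul, Complex.conj_I, Complex.conj_ofReal]
    have : ((a : ℂ) - b) * θ = Real.pi := by
      rw [hθ]
      have h : ((a : ℂ) - b) ≠ 0 := by exact_mod_cast hab'
      push_cast
      field_simp
    rw [← this]; ring
  rw [e, Complex.exp_pi_mul_I]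
  norm_num

/-- For `a ≠ b`, a rotation by `c` multiplies the integral by a number other than 1 without changing
it. -/
theorem integral_Theta_pow_mul_conj_pow {κ : ℝ} (hκ : 0 < κ) (a b : ℕ) :
    ∫ z, z ^ a * (starRingEnd ℂ) z ^ b ∂Theta (2 * κ + 1) =
      if a = b then (diskMoment κ a : ℂ) else 0 := by
  rw [integral_Theta hκ]
  split_ifs with hab
  · subst hab
    rw [← integral_radialDensity hκ, ← integral_complex_ofReal]
    congr 1
    funext z
    rw [← mul_pow, Complex.mul_conj, Complex.normSq_eq_norm_sq, Complex.real_smul]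
    push_cast
    rw [pow_mul]
  · obtain ⟨c, hc⟩ := exists_circle_pow_mul_ne_one hab
    set J := ∫ z, radialDensity κ ‖z‖ • (z ^ a * (starRingEnd ℂ) z ^ b)
    have h := (rotation c).measurePreserving.integral_comp
      (rotation c).toHomeomorph.measurableEmbedding
      (fun z => radialDensity κ ‖z‖ • (z ^ a * (starRingEnd ℂ) z ^ b))
    have h2 : ((c : ℂ) ^ a * (starRingEnd ℂ) (c : ℂ) ^ b) * J = J := by
      rw [← integral_const_mul]
      refine Eq.trans ?_ h
      congr 1
      funext z
      rw [LinearIsometryEquiv.norm_map, rotation_apply, map_mul, mul_pow, mul_pow]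
      simp only [Complex.real_smul]
      ring
    by_contra hJ
    exact hc (mul_right_cancel₀ hJ (by rw [h2, one_mul]))

end Moments

/-! ### The Szegő recursion as a transfer matrix -/

section Transfer

/-- The diagonal factor `diag (e^(-ix/2), e^(ix/2))` of the Szegő transfer matrix. -/
def phase (x : ℂ) : Fin 2 → ℂ :=
  ![Complex.exp (-(Complex.I * x / 2)), Complex.exp (Complex.I * x / 2)]

/-- The random factor of the Szegő transfer matrix. -/
def transfer (a : ℂ) : Matrix (Fin 2) (Fin 2) ℂ :=
  !![1, -a; -(starRingEnd ℂ) a, 1]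

theorem v_zero (a : ℕ → ℂ) (x : ℂ) (i : Fin 2) : v a 0 x i = 1 := by
  fin_cases i <;> simp [v, szego]

/-- The prefactor in `v` splits `e^(ix)` evenly between the two coordinates, which separates the
spectral parameter (diagonal) from the random coefficient. -/
theorem v_succ (a : ℕ → ℂ) (k : ℕ) (x : ℂ) (i : Fin 2) :
    v a (k + 1) x i = ∑ j, transfer (a k) i j * phase x j * v a k x j := by
  have e1 : Complex.exp (-(Complex.I * ((k + 1 : ℕ) : ℂ) * x / 2)) =
      Complex.exp (-(Complex.I * x / 2)) * Complex.exp (-(Complex.I * k * x / 2)) := by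
    rw [← Complex.exp_add]; push_cast; ring_nf
  have e2 : Complex.exp (-(Complex.I * x / 2)) * Complex.exp (Complex.I * x) =
      Complex.exp (Complex.I * x / 2) := by
    rw [← Complex.exp_add]; ring_nf
  fin_cases i
  · simp only [v, e1, szego, Fin.sum_univ_two, transfer, phase, ← e2]
    simp
    ring
  · simp only [v, e1, szego, Fin.sum_univ_two, transfer, phase, ← e2]
    simp
    ring

theorem measurable_szego (k : ℕ) (z : ℂ) : Measurable fun a : ℕ → ℂ => szego a z k := by
  induction k with
  | zero => exact measurable_const
  | succ k ih =>
    have h1 := ih.fst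
    have h2 := ih.snd
    have h3 : Measurable fun a : ℕ → ℂ => a k := measurable_pi_apply k
    have h4 : Measurable fun a : ℕ → ℂ => (starRingEnd ℂ) (a k) :=
      Complex.continuous_conj.measurable.comp h3
    exact ((h1.const_mul z).sub (h4.mul h2)).prodMk (h2.sub ((h3.mul_const z).mul h1))

theorem measurable_vTensor (k : ℕ) {R : ℕ} (x : Fin R → ℂ) (i : G R) :
    Measurable fun a : ℕ → ℂ => vTensor a k x i := by
  refine Finset.measurable_fun_prod _ fun q _ => ?_
  have h := measurable_szego k (Complex.exp (Complex.I * x q))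
  generalize i q = l
  fin_cases l
  · exact h.snd.const_mul _
  · exact h.fst.const_mul _

theorem szego_congr {a b : ℕ → ℂ} (z : ℂ) (k : ℕ) (h : ∀ l < k, a l = b l) :
    szego a z k = szego b z k := by
  induction k with
  | zero => rfl
  | succ k ih =>
    simp only [szego]
    rw [ih fun l hl => h l (by omega), h k (by omega)]

theorem vTensor_congr {a b : ℕ → ℂ} (k : ℕ) {R : ℕ} (x : Fin R → ℂ) (i : G R)
    (h : ∀ l < k, a l = b l) : vTensor a k x i = vTensor b k x i := by
  simp only [vTensor, v]
  simp only [szego_congr _ k h]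

theorem norm_transfer_le {a : ℂ} (ha : ‖a‖ ≤ 1) (i j : Fin 2) : ‖transfer a i j‖ ≤ 1 := by
  fin_cases i <;> fin_cases j <;> simp [transfer, ha]

theorem exists_norm_v_le (k : ℕ) (x : ℂ) :
    ∃ B : ℝ, 0 ≤ B ∧ ∀ a : ℕ → ℂ, (∀ l, ‖a l‖ ≤ 1) → ∀ i, ‖v a k x i‖ ≤ B := by
  induction k with
  | zero => exact ⟨1, zero_le_one, fun a _ i => by simp [v_zero]⟩
  | succ k ih =>
    obtain ⟨B, hB, h⟩ := ih
    refine ⟨∑ j, ‖phase x j‖ * B, by positivity, fun a ha i => ?_⟩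
    rw [v_succ]
    refine norm_sum_le_of_le _ fun j _ => ?_
    rw [norm_mul, norm_mul]
    gcongr
    · exact mul_le_of_le_one_left (norm_nonneg _) (norm_transfer_le (ha k) i j)
    · exact h a ha j

theorem exists_norm_vTensor_le (k : ℕ) {R : ℕ} (x : Fin R → ℂ) (i : G R) :
    ∃ B : ℝ, ∀ a : ℕ → ℂ, (∀ l, ‖a l‖ ≤ 1) → ‖vTensor a k x i‖ ≤ B := by
  choose B hB h using fun q => exists_norm_v_le k (x q)
  refine ⟨∏ q, B q, fun a ha => ?_⟩
  rw [vTensor, norm_prod]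
  exact Finset.prod_le_prod (fun _ _ => norm_nonneg _) fun q _ => h q a ha (i q)

theorem vTensor_succ (a : ℕ → ℂ) (k : ℕ) {R : ℕ} (x : Fin R → ℂ) (i : G R) :
    vTensor a (k + 1) x i = ∑ j : G R, (∏ q, transfer (a k) (i q) (j q)) *
      ((∏ q, phase (x q) (j q)) * vTensor a k x j) := by
  simp only [vTensor, v_succ]
  rw [Finset.prod_univ_sum, Fintype.piFinset_univ]
  simp only [Finset.prod_mul_distrib, mul_assoc]

/-- The number of positions where `i` has label 1 and `j` has label 2. -/
def flips {R : ℕ} (i j : G R) : ℕ := (Finset.univ.filter fun q => i q = 0 ∧ j q = 1).card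

/-- A position contributes `-a`, `-conj a` or `1` according to how the labels of `i` and `j` differ
there, so only the two flip counts matter. -/
theorem prod_transfer (a : ℂ) {R : ℕ} (i j : G R) :
    ∏ q, transfer a (i q) (j q) =
      (-1) ^ (flips i j + flips j i) * (a ^ flips i j * (starRingEnd ℂ) a ^ flips j i) := by
  have h : ∀ q, transfer a (i q) (j q) = (if i q = 0 ∧ j q = 1 then -a else 1) *
      (if j q = 0 ∧ i q = 1 then -(starRingEnd ℂ) a else 1) := by
    intro q
    generalize i q = l
    generalize j q = l'
    fin_cases l <;> fin_cases l' <;> simp [transfer]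
  simp only [h, Finset.prod_mul_distrib, Finset.prod_ite, Finset.prod_const, flips,
    one_pow, mul_one]
  rw [neg_pow a, neg_pow ((starRingEnd ℂ) a), pow_add]
  ring

theorem measurable_prod_transfer {R : ℕ} (i j : G R) :
    Measurable fun a : ℂ => ∏ q, transfer a (i q) (j q) := by
  simp only [prod_transfer]
  have := Complex.continuous_conj
  exact (by fun_prop : Continuous _).measurable

theorem integral_prod_transfer {κ : ℝ} (hκ : 0 < κ) {R : ℕ} (i j : G R) :
    ∫ a, ∏ q, transfer a (i q) (j q) ∂Theta (2 * κ + 1) =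
      if flips i j = flips j i then (diskMoment κ (flips i j) : ℂ) else 0 := by
  simp only [prod_transfer]
  rw [integral_const_mul, integral_Theta_pow_mul_conj_pow hκ]
  split_ifs with h
  · rw [← h, ← two_mul, pow_mul]; simp
  · simp

end Transfer

/-! ### The recursion for the expectations -/

section Expectation

variable {Ω : Type*} [MeasurableSpace Ω] {P : Measure Ω} {α : ℕ → Ω → ℂ}

theorem ae_norm_le_one {ν : ℕ → ℝ} (hlaw : ∀ k, HasLaw (α k) (Theta (ν k)) P) :
    ∀ᵐ ω ∂P, ∀ k, ‖α k ω‖ ≤ 1 := by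
  rw [ae_all_iff]
  intro k
  have h := Theta_ae_norm_lt_one (ν k)
  rw [← (hlaw k).map_eq] at h
  filter_upwards [ae_of_ae_map (hlaw k).aemeasurable h] with ω hω using hω.le

theorem aestronglyMeasurable_vTensor (hα : ∀ k, AEMeasurable (α k) P) (k : ℕ) {R : ℕ}
    (x : Fin R → ℂ) (i : G R) :
    AEStronglyMeasurable (fun ω => vTensor (fun l => α l ω) k x i) P :=
  ((measurable_vTensor k x i).comp_aemeasurable (aemeasurable_pi_lambda _ hα)).aestronglyMeasurable

theorem integrable_vTensor [IsProbabilityMeasure P] {ν : ℕ → ℝ} (hlaw : ∀ k, HasLaw (α k) (Theta (ν k)) P) (k : ℕ) {R : ℕ}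
    (x : Fin R → ℂ) (i : G R) : Integrable (fun ω => vTensor (fun l => α l ω) k x i) P := by
  obtain ⟨B, hB⟩ := exists_norm_vTensor_le k x i
  refine .of_bound (aestronglyMeasurable_vTensor (fun k => (hlaw k).aemeasurable) k x i) B ?_
  filter_upwards [ae_norm_le_one hlaw] with ω hω using hB _ hω

/-- The tensor at step `k` involves only the coefficients of index below `k`. -/
theorem indepFun_vTensor (hα : ∀ k, AEMeasurable (α k) P) (hindep : iIndepFun α P) (k : ℕ) {R : ℕ}
    (x : Fin R → ℂ) (i : G R) {F : ℂ → ℂ} (hF : Measurable F) :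
    IndepFun (fun ω => F (α k ω)) (fun ω => vTensor (fun l => α l ω) k x i) P := by
  classical
  have h := hindep.indepFun_finset₀ {k} (Finset.range k) (by simp) hα
  have hg : Measurable fun b : Finset.range k → ℂ =>
      vTensor (fun l => if hl : l ∈ Finset.range k then b ⟨l, hl⟩ else 0) k x i := by
    refine (measurable_vTensor k x i).comp (measurable_pi_lambda _ fun l => ?_)
    split_ifs with hl
    · exact measurable_pi_apply _
    · exact measurable_const
  have hf : Measurable fun b : ({k} : Finset ℕ) → ℂ => F (b ⟨k, Finset.mem_singleton_self k⟩) :=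
    hF.comp (measurable_pi_apply _)
  have h2 := h.comp hf hg
  convert h2 using 1
  · rfl
  · funext ω
    refine vTensor_congr k x i fun l hl => ?_
    simp [hl]

theorem integral_vTensor_succ [IsProbabilityMeasure P] {κ : ℕ → ℝ} (hκ : ∀ k, 0 < κ k)
    (hlaw : ∀ k, HasLaw (α k) (Theta (2 * κ k + 1)) P) (hindep : iIndepFun α P) (k : ℕ) {R : ℕ}
    (x : Fin R → ℂ) (i : G R) :
    ∫ ω, vTensor (fun l => α l ω) (k + 1) x i ∂P = ∑ j : G R,
      (if flips i j = flips j i then (diskMoment (κ k) (flips i j) : ℂ) else 0) *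
        ((∏ q, phase (x q) (j q)) * ∫ ω, vTensor (fun l => α l ω) k x j ∂P) := by
  have hα := fun k => (hlaw k).aemeasurable
  simp only [vTensor_succ]
  rw [integral_finsetSum]
  · refine Finset.sum_congr rfl fun j _ => ?_
    have hind := indepFun_vTensor hα hindep k x j (measurable_prod_transfer i j)
    have h := hind.integral_fun_mul_eq_mul_integral
      ((measurable_prod_transfer i j).comp_aemeasurable (hα k)).aestronglyMeasurable
      (aestronglyMeasurable_vTensor hα k x j)
    have h2 := (hlaw k).integral_comp (f := fun a => ∏ q, transfer a (i q) (j q))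
      (measurable_prod_transfer i j).aestronglyMeasurable
    rw [integral_prod_transfer (hκ k)] at h2
    simp only [Function.comp_def] at h2
    rw [h2] at h
    simp only [mul_left_comm _ (∏ q, phase (x q) (j q))]
    rw [integral_const_mul, h]
  · intro j _
    refine Integrable.bdd_mul (c := 1) ((integrable_vTensor hlaw k x j).const_mul _)
      ((measurable_prod_transfer i j).comp_aemeasurable (hα k)).aestronglyMeasurable ?_
    filter_upwards [ae_norm_le_one hlaw] with ω hω
    simp only [norm_prod]
    exact Finset.prod_le_one (fun _ _ => norm_nonneg _) fun q _ => norm_transfer_le (hω k) _ _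

end Expectation

/-! ### Graph Laplacians: maximum principle and energy estimate -/

section Laplacian

variable {ι : Type*} [Fintype ι]

/-- The weighted graph Laplacian `u ↦ (∑ j, a i j (u i - u j))_i`. -/
def lapl (a : ι → ι → ℝ) : (ι → ℂ) →L[ℝ] (ι → ℂ) :=
  LinearMap.toContinuousLinearMap
    { toFun := fun u i => ∑ j, a i j • (u i - u j)
      map_add' := fun u u' => by
        funext i
        simp only [Pi.add_apply, ← Finset.sum_add_distrib, ← smul_add]
        exact Finset.sum_congr rfl fun j _ => by congr 1; ring
      map_smul' := fun c u => by
        funext i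
        simp only [Pi.smul_apply, Finset.smul_sum, RingHom.id_apply, ← smul_sub]
        exact Finset.sum_congr rfl fun j _ => smul_comm _ _ _ }

theorem lapl_apply (a : ι → ι → ℝ) (u : ι → ℂ) (i : ι) :
    lapl a u i = ∑ j, a i j • (u i - u j) := rfl

theorem lapl_const (a : ι → ι → ℝ) (c : ℂ) : lapl a (fun _ => c) = 0 := by
  funext i; simp [lapl_apply]

theorem norm_lapl_le {a : ι → ι → ℝ} {B : ℝ} (hB : 0 ≤ B) (ha : ∀ i j, i ≠ j → |a i j| ≤ B)
    (u : ι → ℂ) : ‖lapl a u‖ ≤ Fintype.card ι * (2 * B) * ‖u‖ := by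
  rw [pi_norm_le_iff_of_nonneg (by positivity)]
  intro i
  rw [lapl_apply]
  have : ∀ j ∈ Finset.univ, ‖a i j • (u i - u j)‖ ≤ 2 * B * ‖u‖ := by
    intro j _
    by_cases hij : i = j
    · subst hij
      rw [sub_self, smul_zero, norm_zero]; positivity
    · rw [norm_smul, Real.norm_eq_abs]
      have h1 := norm_sub_le (u i) (u j)
      have h2 := norm_le_pi_norm u i
      have h3 := norm_le_pi_norm u j
      calc _ ≤ B * (2 * ‖u‖) := by
            gcongr
            · exact ha i j hij
            · linarith
        _ = _ := by ring
  refine (norm_sum_le_of_le _ this).trans (le_of_eq ?_)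
  rw [Finset.sum_const, Finset.card_univ, nsmul_eq_mul, ← mul_assoc]

/-- The maximum principle: the graph Laplacian is accretive for the sup norm. -/
theorem le_norm_smul_add_lapl {a : ι → ι → ℝ} (ha : ∀ i j, 0 ≤ a i j) (c : ℝ) (u : ι → ℂ)
    (hc : 0 ≤ c) : c * ‖u‖ ≤ ‖c • u + lapl a u‖ := by
  rcases isEmpty_or_nonempty ι with hι | hι
  · rw [Subsingleton.elim u 0]; simp
  -- At a coordinate of maximal modulus the neighbours cannot outweigh the diagonal term.
  obtain ⟨i, hi⟩ := Finite.exists_max fun i => ‖u i‖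
  have hu : ‖u‖ ≤ ‖u i‖ := (pi_norm_le_iff_of_nonneg (norm_nonneg _)).2 hi
  have hs : 0 ≤ ∑ j, a i j := Finset.sum_nonneg fun j _ => ha i j
  have e : (c + ∑ j, a i j) • u i = (c • u + lapl a u) i + ∑ j, a i j • u j := by
    rw [Pi.add_apply, Pi.smul_apply, lapl_apply, add_assoc, ← Finset.sum_add_distrib]
    simp only [← smul_add, sub_add_cancel, add_smul, Finset.sum_smul]
  have h1 : ‖∑ j, a i j • u j‖ ≤ (∑ j, a i j) * ‖u i‖ := by
    rw [Finset.sum_mul]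
    refine norm_sum_le_of_le _ fun j _ => ?_
    rw [norm_smul, Real.norm_of_nonneg (ha i j)]
    exact mul_le_mul_of_nonneg_left (hi j) (ha i j)
  have h2 := norm_add_le ((c • u + lapl a u) i) (∑ j, a i j • u j)
  rw [← e, norm_smul, Real.norm_of_nonneg (by positivity)] at h2
  have h3 := norm_le_pi_norm (c • u + lapl a u) i
  have h4 := mul_le_mul_of_nonneg_left hu hc
  linarith

/-- Multiplication by a fixed function. -/
def diagOp (d : ι → ℂ) : (ι → ℂ) →L[ℝ] (ι → ℂ) :=
  LinearMap.toContinuousLinearMap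
    { toFun := fun u i => d i * u i
      map_add' := fun u u' => by funext i; simp [mul_add]
      map_smul' := fun c u => by funext i; simp [mul_left_comm] }

theorem diagOp_apply (d u : ι → ℂ) (i : ι) : diagOp d u i = d i * u i := rfl

theorem norm_diagOp_exp_sub_le (d : ι → ℂ) {h : ℝ} (h0 : 0 ≤ h) (h1 : h ≤ 1) (u : ι → ℂ) :
    ‖diagOp (fun i => Complex.exp (h * d i)) u - u - h • diagOp d u‖ ≤
      ‖d‖ ^ 2 * Real.exp ‖d‖ * h ^ 2 * ‖u‖ := by
  rw [pi_norm_le_iff_of_nonneg (by positivity)]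
  intro i
  have e : (diagOp (fun i => Complex.exp (h * d i)) u - u - h • diagOp d u) i =
      (Complex.exp (h * d i) - ∑ m ∈ Finset.range 2, (h * d i) ^ m / m.factorial) * u i := by
    simp only [Pi.sub_apply, Pi.smul_apply, diagOp_apply, Complex.real_smul, Finset.sum_range_succ,
      Finset.range_zero, Finset.sum_empty, pow_zero, Nat.factorial, Nat.cast_one]
    ring
  rw [e, norm_mul]
  refine mul_le_mul ?_ (norm_le_pi_norm u i) (norm_nonneg _) (by positivity)
  refine (Complex.norm_exp_sub_sum_le_norm_mul_exp _ 2).trans ?_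
  have hd := norm_le_pi_norm d i
  rw [norm_mul, Complex.norm_real, Real.norm_of_nonneg h0, mul_pow]
  have : h * ‖d i‖ ≤ ‖d‖ := (mul_le_of_le_one_left (norm_nonneg _) h1).trans hd
  calc _ ≤ h ^ 2 * ‖d‖ ^ 2 * Real.exp ‖d‖ := by gcongr
    _ = _ := by ring

/-- Twice `inner (u i) (u i - u j)` dominates `‖u i‖ ^ 2 - ‖u j‖ ^ 2`, whose sum against symmetric
weights is zero. -/
theorem sum_inner_lapl_nonneg {a : ι → ι → ℝ} (ha : ∀ i j, 0 ≤ a i j)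
    (hsymm : ∀ i j, a i j = a j i) (u : ι → ℂ) : 0 ≤ ∑ i, inner ℝ (u i) (lapl a u i) := by
  have h0 : ∑ i, ∑ j, a i j * (‖u i‖ ^ 2 - ‖u j‖ ^ 2) = 0 := by
    simp only [mul_sub, Finset.sum_sub_distrib]
    rw [sub_eq_zero, Finset.sum_comm]
    exact Finset.sum_congr rfl fun i _ => Finset.sum_congr rfl fun j _ => by rw [hsymm]
  have h1 : ∑ i, ∑ j, a i j * (‖u i‖ ^ 2 - ‖u j‖ ^ 2) ≤
      ∑ i, ∑ j, 2 * (a i j * inner ℝ (u i) (u i - u j)) := by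
    refine Finset.sum_le_sum fun i _ => Finset.sum_le_sum fun j _ => ?_
    rw [← mul_left_comm]
    refine mul_le_mul_of_nonneg_left ?_ (ha i j)
    rw [inner_sub_right, real_inner_self_eq_norm_sq]
    nlinarith [real_inner_le_norm (u i) (u j), sq_nonneg (‖u i‖ - ‖u j‖)]
  simp only [← Finset.mul_sum] at h1
  simp only [lapl_apply, inner_sum, inner_smul_right]
  linarith

/-- A solution of `t z' = -lapl a z + t d z` on `(0, ∞)` which is `O(t)` at `0` vanishes. -/
theorem eq_zero_of_hasDerivAt_lapl {a : ι → ι → ℝ} (ha : ∀ i j, 0 ≤ a i j)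
    (hsymm : ∀ i j, a i j = a j i) (d : ι → ℂ) {z : ℝ → ι → ℂ}
    (hz : ∀ t, 0 < t → HasDerivAt z (diagOp d (z t) - t⁻¹ • lapl a (z t)) t)
    (h0 : z =O[𝓝[>] (0 : ℝ)] fun t : ℝ => t) {t : ℝ} (ht : 0 < t) : z t = 0 := by
  set M := ‖d‖
  -- The Laplacian can only decrease the energy `q`, so `q' ≤ 2 M q`. Thus `exp (-2 M t) q` is
  -- antitone on `(0, ∞)`, and it tends to 0 at 0.
  set q : ℝ → ℝ := fun t => ∑ i, ‖z t i‖ ^ 2 with hq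
  set q' : ℝ → ℝ := fun t => ∑ i, 2 * inner ℝ (z t i) ((diagOp d (z t) - t⁻¹ • lapl a (z t)) i)
  have hq' : ∀ t, 0 < t → HasDerivAt q (q' t) t := fun t ht =>
    HasDerivAt.fun_sum fun i _ => (hasDerivAt_pi.1 (hz t ht) i).norm_sq
  have hle : ∀ t, 0 < t → q' t ≤ 2 * M * q t := by
    intro t ht
    have h1 : ∑ i, inner ℝ (z t i) (d i * z t i) ≤ M * q t := by
      rw [hq, Finset.mul_sum]
      refine Finset.sum_le_sum fun i _ => (real_inner_le_norm _ _).trans ?_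
      rw [norm_mul, mul_left_comm, ← pow_two]
      exact mul_le_mul_of_nonneg_right (norm_le_pi_norm d i) (by positivity)
    have h2 := mul_nonneg (inv_nonneg.2 ht.le) (sum_inner_lapl_nonneg ha hsymm (z t))
    have h3 : q' t = 2 * (∑ i, inner ℝ (z t i) (d i * z t i) -
        t⁻¹ * ∑ i, inner ℝ (z t i) (lapl a (z t) i)) := by
      simp only [q', Pi.sub_apply, Pi.smul_apply, inner_sub_right, inner_smul_right, diagOp_apply,
        ← Finset.mul_sum, Finset.sum_sub_distrib]
    rw [h3]
    linarith
  set g : ℝ → ℝ := fun t => Real.exp (-(2 * M * t)) * q t with hg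
  have hg' : ∀ t, 0 < t → HasDerivAt g
      (Real.exp (-(2 * M * t)) * (-(2 * M)) * q t + Real.exp (-(2 * M * t)) * q' t) t := by
    intro t ht
    have h1 : HasDerivAt (fun t : ℝ => -(2 * M * t)) (-(2 * M)) t := by
      simpa using ((hasDerivAt_id' t).const_mul (2 * M)).fun_neg
    exact h1.exp.fun_mul (hq' t ht)
  have hanti : AntitoneOn g (Set.Ioi 0) := by
    refine antitoneOn_of_deriv_nonpos (convex_Ioi 0)
      (fun t ht => (hg' t ht).continuousAt.continuousWithinAt)
      (fun t ht => (hg' t (by simpa using ht)).differentiableAt.differentiableWithinAt) ?_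
    intro t ht
    rw [interior_Ioi] at ht
    rw [(hg' t ht).deriv]
    have := mul_le_mul_of_nonneg_left (hle t ht) (Real.exp_pos (-(2 * M * t))).le
    linarith
  have hz0 : Tendsto z (𝓝[>] 0) (𝓝 0) :=
    h0.trans_tendsto (tendsto_nhdsWithin_of_tendsto_nhds tendsto_id)
  have hg0 : Tendsto g (𝓝[>] 0) (𝓝 0) := by
    have h1 : Tendsto q (𝓝[>] 0) (𝓝 0) := by
      have h2 : Tendsto (fun u : ι → ℂ => ∑ i, ‖u i‖ ^ 2) (𝓝 0) (𝓝 0) := by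
        have h3 : Continuous fun u : ι → ℂ => ∑ i, ‖u i‖ ^ 2 := by fun_prop
        simpa using h3.tendsto 0
      exact h2.comp hz0
    have h2 : Tendsto (fun t : ℝ => Real.exp (-(2 * M * t))) (𝓝[>] 0) (𝓝 1) := by
      have h3 : Continuous fun t : ℝ => Real.exp (-(2 * M * t)) := by fun_prop
      simpa using (h3.tendsto 0).mono_left nhdsWithin_le_nhds
    simpa using h2.mul h1
  have hgt : g t ≤ 0 := by
    refine ge_of_tendsto hg0 ?_
    filter_upwards [Ioo_mem_nhdsGT ht] with s hs
    exact hanti hs.1 ht hs.2.le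
  have hqt : q t ≤ 0 := by
    by_contra hcon
    push Not at hcon
    have := mul_pos (Real.exp_pos (-(2 * M * t))) hcon
    exact absurd hgt (not_le.2 this)
  have hq0 : q t = 0 := le_antisymm hqt (by positivity)
  rw [hq, Finset.sum_eq_zero_iff_of_nonneg (fun i _ => by positivity)] at hq0
  funext i
  simpa using hq0 i (Finset.mem_univ i)

end Laplacian

/-! ### Combinatorics of flips on `Gr R r` -/

section Johnson

variable {R r : ℕ}

theorem card_add_flips (i j : G R) :
    (Finset.univ.filter fun q => i q = 0).card + flips j i =
      (Finset.univ.filter fun q => j q = 0).card + flips i j := by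
  simp only [flips, Finset.card_filter, ← Finset.sum_add_distrib]
  refine Finset.sum_congr rfl fun q _ => ?_
  generalize i q = l
  generalize j q = l'
  fin_cases l <;> fin_cases l' <;> simp

/-- This is why the averaged step, which vanishes for unbalanced flips, does not leave `Gr R r`. -/
theorem flips_eq_flips_iff (i : Gr R r) (j : G R) :
    flips i.1 j = flips j i.1 ↔ (Finset.univ.filter fun q => j q = 0).card = r := by
  have h := card_add_flips i.1 j
  rw [i.2] at h
  omega

theorem flips_comm (i j : Gr R r) : flips i.1 j.1 = flips j.1 i.1 :=
  (flips_eq_flips_iff i j.1).2 j.2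

theorem card_ne_eq_flips_add (i j : G R) :
    (Finset.univ.filter fun q => i q ≠ j q).card = flips i j + flips j i := by
  simp only [flips, Finset.card_filter, ← Finset.sum_add_distrib]
  refine Finset.sum_congr rfl fun q _ => ?_
  generalize i q = l
  generalize j q = l'
  fin_cases l <;> fin_cases l' <;> simp

theorem sum_sub_eq_flips_sub (i j : G R) :
    ∑ q, (((i q : ℕ) : ℤ) - ((j q : ℕ) : ℤ)) = (flips j i : ℤ) - flips i j := by
  simp only [flips, Finset.card_filter]
  push_cast
  rw [← Finset.sum_sub_distrib]
  refine Finset.sum_congr rfl fun q _ => ?_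
  generalize i q = l
  generalize j q = l'
  fin_cases l <;> fin_cases l' <;> simp

theorem restrict_Delta_apply (i j : Gr R r) :
    restrict r (Delta R) i j = if flips i.1 j.1 = 1 then 1 else 0 := by
  rw [restrict, Matrix.submatrix_apply, Delta, card_ne_eq_flips_add, sum_sub_eq_flips_sub,
    flips_comm j i]
  refine if_congr ?_ rfl rfl
  simp only [sub_self, and_true]
  omega

theorem eq_of_flips_eq_zero {i j : Gr R r} (h : flips i.1 j.1 = 0) : i = j := by
  have h2 : (Finset.univ.filter fun q => i.1 q ≠ j.1 q).card = 0 := by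
    rw [card_ne_eq_flips_add, flips_comm j i, h]
  rw [Finset.card_eq_zero, Finset.filter_eq_empty_iff] at h2
  ext1
  funext q
  simpa using h2 (Finset.mem_univ q)

theorem flips_le (i : Gr R r) (j : G R) : flips i.1 j ≤ r := by
  refine le_trans (Finset.card_le_card fun q hq => ?_) i.2.le
  simp only [Finset.mem_filter, Finset.mem_univ, true_and] at hq ⊢
  exact hq.1

theorem card_filter_one (i : Gr R r) :
    (Finset.univ.filter fun q => i.1 q = 1).card = R - r := by
  have h := Finset.card_filter_add_card_filter_not (s := Finset.univ) fun q => i.1 q = 0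
  rw [i.2, Finset.card_univ, Fintype.card_fin] at h
  have : (Finset.univ.filter fun q => ¬ i.1 q = 0) = Finset.univ.filter fun q => i.1 q = 1 := by
    ext q
    simp only [Finset.mem_filter, Finset.mem_univ, true_and]
    generalize i.1 q = l
    fin_cases l <;> simp
  rw [this] at h
  omega

/-- Such a `j` amounts to a choice of `m` positions with label 1 and `m` with label 2 in `i`, whose
labels are exchanged. -/
theorem card_flips_eq (i : Gr R r) (m : ℕ) :
    (Finset.univ.filter fun j : Gr R r => flips i.1 j.1 = m).card =
      r.choose m * (R - r).choose m := by
  set Z := Finset.univ.filter fun q => i.1 q = 0 with hZ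
  set O := Finset.univ.filter fun q => i.1 q = 1 with hO
  have hcard : (Z.powersetCard m ×ˢ O.powersetCard m).card = r.choose m * (R - r).choose m := by
    rw [Finset.card_product, Finset.card_powersetCard, Finset.card_powersetCard, hZ, i.2, hO,
      card_filter_one]
  rw [← hcard]
  have hfin : ∀ l : Fin 2, l = 0 ∨ l = 1 := by decide
  refine Finset.card_bij
    (fun j _ => (Finset.univ.filter fun q => i.1 q = 0 ∧ j.1 q = 1,
      Finset.univ.filter fun q => j.1 q = 0 ∧ i.1 q = 1)) ?_ ?_ ?_
  · intro j hj
    have hj' : flips i.1 j.1 = m := by simpa using hj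
    rw [Finset.mem_product, Finset.mem_powersetCard, Finset.mem_powersetCard]
    refine ⟨⟨fun q hq => ?_, hj'⟩, fun q hq => ?_, by rw [← hj', flips_comm]; rfl⟩
    · simp only [hZ, Finset.mem_filter, Finset.mem_univ, true_and] at hq ⊢
      exact hq.1
    · simp only [hO, Finset.mem_filter, Finset.mem_univ, true_and] at hq ⊢
      exact hq.2
  · intro j _ j' _ h
    rw [Prod.mk.injEq, Finset.ext_iff, Finset.ext_iff] at h
    simp only [Finset.mem_filter, Finset.mem_univ, true_and] at h
    ext1
    funext q
    have h1 := h.1 q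
    have h2 := h.2 q
    rcases hfin (i.1 q) with hi | hi <;> rcases hfin (j.1 q) with hj | hj <;>
      rcases hfin (j'.1 q) with hj' | hj' <;> simp_all
  · rintro ⟨A, B⟩ hAB
    rw [Finset.mem_product, Finset.mem_powersetCard, Finset.mem_powersetCard] at hAB
    obtain ⟨⟨hA, hAm⟩, hB, hBm⟩ := hAB
    have hA' : ∀ q ∈ A, i.1 q = 0 := fun q hq => by simpa [hZ] using hA hq
    have hB' : ∀ q ∈ B, i.1 q = 1 := fun q hq => by simpa [hO] using hB hq
    let j : G R := fun q => if q ∈ A then 1 else if q ∈ B then 0 else i.1 q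
    have eA : (Finset.univ.filter fun q => i.1 q = 0 ∧ j q = 1) = A := by
      ext q
      simp only [Finset.mem_filter, Finset.mem_univ, true_and, j]
      by_cases hqA : q ∈ A
      · simp [hqA, hA' q hqA]
      · by_cases hqB : q ∈ B <;> simp [hqA, hqB]
        intro h; simp [h]
    have eB : (Finset.univ.filter fun q => j q = 0 ∧ i.1 q = 1) = B := by
      ext q
      simp only [Finset.mem_filter, Finset.mem_univ, true_and, j]
      by_cases hqA : q ∈ A
      · have : q ∉ B := fun h => by simpa [hA' q hqA] using hB' q h
        simp [hqA, this]
      · by_cases hqB : q ∈ B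
        · simp [hqA, hqB, hB' q hqB]
        · simp only [hqA, hqB, if_false, iff_false, not_and]
          intro h; simp [h]
    have hfl : flips i.1 j = m := by rw [flips, eA, hAm]
    have hfl' : flips j i.1 = m := by rw [flips, eB, hBm]
    refine ⟨⟨j, (flips_eq_flips_iff i j).1 (hfl.trans hfl'.symm)⟩, by simpa using hfl, ?_⟩
    simp only [eA, eB]

theorem sum_comp_flips (i : Gr R r) (f : ℕ → ℝ) :
    ∑ j : Gr R r, f (flips i.1 j.1) =
      ∑ m ∈ Finset.range (r + 1), (r.choose m * (R - r).choose m : ℝ) * f m := by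
  rw [← Finset.sum_fiberwise_of_maps_to (s := Finset.univ) (t := Finset.range (r + 1))
    (g := fun j : Gr R r => flips i.1 j.1)
    fun j _ => Finset.mem_range.2 (Nat.lt_succ_of_le (flips_le i j.1))]
  refine Finset.sum_congr rfl fun m _ => ?_
  rw [Finset.sum_congr rfl fun j hj => by rw [(Finset.mem_filter.1 hj).2], Finset.sum_const,
    card_flips_eq, nsmul_eq_mul]
  push_cast
  rfl

theorem sum_flips_eq_one (i : Gr R r) :
    ∑ j : Gr R r, (if flips i.1 j.1 = 1 then (1 : ℝ) else 0) = r * ((R - r : ℕ) : ℝ) := by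
  rw [sum_comp_flips i fun m => if m = 1 then (1 : ℝ) else 0]
  simp only [mul_ite, mul_one, mul_zero, Finset.sum_ite_eq', Finset.mem_range]
  split_ifs with h
  · simp
  · have : r = 0 := by omega
    simp [this]

end Johnson

/-! ### Row sums of the averaged transfer matrix -/

section Eigenvalue

/-- The row sums of the matrix `(diskMoment κ (flips i j))` on `Gr (r + s) r`. -/
def rowSum (κ : ℝ) (r s : ℕ) : ℝ :=
  ∑ m ∈ Finset.range (r + 1), (r.choose m * s.choose m : ℝ) * diskMoment κ m

theorem diskMoment_succ_eq (κ : ℝ) (m : ℕ) :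
    diskMoment κ (m + 1) = (m + 1) / (κ + 1) * diskMoment (κ + 1) m := by
  rw [diskMoment, diskMoment, Finset.prod_range_succ', Nat.factorial_succ, div_mul_div_comm,
    mul_comm (κ + 1)]
  push_cast
  congr 2
  · refine Finset.prod_congr rfl fun l _ => ?_
    ring
  · ring

/-- Pascal's rule in `r` leaves an extra sum; absorbing `m + 1` into the binomial in `s` and
shifting `κ` identifies it as a smaller row sum. -/
theorem rowSum_succ (κ : ℝ) (r s : ℕ) :
    rowSum κ (r + 1) (s + 1) = rowSum κ r (s + 1) + (s + 1) / (κ + 1) * rowSum (κ + 1) r s := by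
  have h1 : rowSum κ (r + 1) (s + 1) = rowSum κ r (s + 1) +
      ∑ m ∈ Finset.range (r + 1), (r.choose m * (s + 1).choose (m + 1) : ℝ) *
        diskMoment κ (m + 1) := by
    have h2 : rowSum κ r (s + 1) = ∑ m ∈ Finset.range (r + 1 + 1),
        (r.choose m * (s + 1).choose m : ℝ) * diskMoment κ m := by
      rw [Finset.sum_range_succ _ (r + 1), rowSum]
      simp
    rw [h2, rowSum, Finset.sum_range_succ' _ (r + 1), Finset.sum_range_succ' _ (r + 1), add_right_comm,
      ← Finset.sum_add_distrib]
    congr 1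
    · refine Finset.sum_congr rfl fun m _ => ?_
      rw [Nat.choose_succ_succ]
      push_cast
      ring
    · simp
  rw [h1, rowSum, rowSum, Finset.mul_sum]
  congr 1
  refine Finset.sum_congr rfl fun m _ => ?_
  have h3 : ((s : ℝ) + 1) * s.choose m = (s + 1).choose (m + 1) * (m + 1) := by
    exact_mod_cast Nat.add_one_mul_choose_eq s m
  rw [diskMoment_succ_eq]
  calc _ = (r.choose m : ℝ) * ((s + 1).choose (m + 1) * (m + 1)) / (κ + 1) *
        diskMoment (κ + 1) m := by ring
    _ = _ := by rw [← h3]; ring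

/-- The Chu–Vandermonde evaluation of the row sums. -/
theorem rowSum_eq_prod (r : ℕ) {κ : ℝ} (hκ : 0 < κ) (s : ℕ) :
    rowSum κ r s = ∏ p ∈ Finset.range r, (κ + s + (p + 1)) / (κ + (p + 1)) := by
  induction r generalizing κ s with
  | zero => simp [rowSum, diskMoment_zero]
  | succ r ih =>
    rcases s with _ | s
    · rw [rowSum, Finset.sum_range_succ']
      simp only [CharP.cast_eq_zero, add_zero, diskMoment_zero, Nat.choose_zero_succ, mul_zero,
        zero_mul, Finset.sum_const_zero, Nat.choose_zero_right, Nat.cast_one, mul_one, zero_add]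
      refine (Finset.prod_eq_one fun p _ => div_self ?_).symm
      positivity
    · rw [rowSum_succ, ih hκ, ih (by positivity : 0 < κ + 1)]
      have hne : ∀ p : ℕ, κ + ((p : ℝ) + 1) ≠ 0 := fun p => by positivity
      have hne' : ∀ p : ℕ, κ + 1 + ((p : ℝ) + 1) ≠ 0 := fun p => by positivity
      simp only [Finset.prod_div_distrib]
      have e1 : ∏ p ∈ Finset.range r, (κ + 1 + (s : ℝ) + (p + 1)) =
          ∏ p ∈ Finset.range r, (κ + ((s + 1 : ℕ) : ℝ) + (p + 1)) :=
        Finset.prod_congr rfl fun p _ => by push_cast; ring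
      have e2 : (κ + 1) * ∏ p ∈ Finset.range r, (κ + 1 + ((p : ℝ) + 1)) =
          ∏ p ∈ Finset.range (r + 1), (κ + ((p : ℝ) + 1)) := by
        rw [Finset.prod_range_succ', mul_comm]
        congr 1
        · exact Finset.prod_congr rfl fun p _ => by push_cast; ring
        · simp
      have hP := Finset.prod_ne_zero_iff.2 fun p (_ : p ∈ Finset.range r) => hne p
      have hQ := Finset.prod_ne_zero_iff.2 fun p (_ : p ∈ Finset.range r) => hne' p
      rw [e1, div_mul_div_comm, e2, Finset.prod_range_succ, Finset.prod_range_succ]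
      have := hne r
      field_simp
      push_cast
      ring

theorem diskMoment_pos {κ : ℝ} (hκ : 0 < κ) (m : ℕ) : 0 < diskMoment κ m := by
  rw [diskMoment]
  have : 0 < ∏ l ∈ Finset.range m, (κ + 1 + l) := Finset.prod_pos fun l _ => by positivity
  positivity

theorem diskMoment_antitone {κ : ℝ} (hκ : 0 < κ) : Antitone (diskMoment κ) := by
  refine antitone_nat_of_succ_le fun m => ?_
  rw [diskMoment_succ]
  refine mul_le_of_le_one_left (diskMoment_pos hκ m).le ?_
  rw [div_le_one (by positivity)]
  linarith

theorem one_le_rowSum {κ : ℝ} (hκ : 0 < κ) (r s : ℕ) : 1 ≤ rowSum κ r s := by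
  rw [rowSum, Finset.sum_range_succ']
  have : 0 ≤ ∑ m ∈ Finset.range r, (r.choose (m + 1) * s.choose (m + 1) : ℝ) *
      diskMoment κ (m + 1) :=
    Finset.sum_nonneg fun m _ => mul_nonneg (by positivity) (diskMoment_pos hκ _).le
  simp only [Nat.choose_zero_right, Nat.cast_one, mul_one, diskMoment_zero]
  linarith

theorem diskMoment_one (κ : ℝ) : diskMoment κ 1 = 1 / (κ + 1) := by
  simp [diskMoment]

theorem diskMoment_one_le {κ : ℝ} (hκ : 0 < κ) : diskMoment κ 1 ≤ 1 / κ := by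
  rw [diskMoment_one]
  exact one_div_le_one_div_of_le hκ (by linarith)

theorem exists_rowSum_sub_one_le (r s : ℕ) :
    ∃ B : ℝ, 0 ≤ B ∧ ∀ κ : ℝ, 0 < κ → rowSum κ r s - 1 ≤ B * (1 / κ) := by
  refine ⟨∑ m ∈ Finset.range r, (r.choose (m + 1) * s.choose (m + 1) : ℝ), by positivity,
    fun κ hκ => ?_⟩
  rw [rowSum, Finset.sum_range_succ']
  simp only [Nat.choose_zero_right, Nat.cast_one, mul_one, diskMoment_zero,
    add_sub_cancel_right]
  rw [Finset.sum_mul]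
  gcongr with m
  exact (diskMoment_antitone hκ (by omega : 1 ≤ m + 1)).trans (diskMoment_one_le hκ)

/-- To first order in `1 / κ` only single exchanges survive: moments with `m ≥ 2` are `O(1 / κ ^
2)`, and the row sum is `1 + O(1 / κ)`. -/
theorem exists_diskMoment_div_rowSum_sub_le (r s : ℕ) :
    ∃ B : ℝ, 0 ≤ B ∧ ∀ κ : ℝ, 0 < κ → ∀ m : ℕ, 1 ≤ m →
      |diskMoment κ m / rowSum κ r s - (if m = 1 then 1 / κ else 0)| ≤ B * (1 / κ) ^ 2 := by
  obtain ⟨B, hB, h⟩ := exists_rowSum_sub_one_le r s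
  refine ⟨B + 2, by positivity, fun κ hκ m hm => ?_⟩
  have h1 := one_le_rowSum hκ r s
  have h2 := h κ hκ
  set lam := rowSum κ r s
  have hlam : 0 < lam := by linarith
  have hκ' : 0 < 1 / κ := by positivity
  split_ifs with hm1
  · subst hm1
    have hc := diskMoment_one_le hκ
    have hc0 := diskMoment_pos hκ 1
    have hdiff : 1 / κ - diskMoment κ 1 ≤ (1 / κ) ^ 2 := by
      rw [diskMoment_one, div_sub_div _ _ hκ.ne' (by positivity), div_pow,
        div_le_div_iff₀ (by positivity) (by positivity)]
      nlinarith
    have hup : diskMoment κ 1 / lam ≤ diskMoment κ 1 := div_le_self hc0.le h1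
    have hlo : diskMoment κ 1 - diskMoment κ 1 * (lam - 1) ≤ diskMoment κ 1 / lam := by
      rw [le_div_iff₀ hlam]
      nlinarith [mul_nonneg hc0.le (sq_nonneg (lam - 1))]
    have hmul : diskMoment κ 1 * (lam - 1) ≤ 1 / κ * (B * (1 / κ)) :=
      mul_le_mul hc h2 (by linarith) hκ'.le
    rw [abs_le]
    constructor <;> nlinarith [sq_nonneg (1 / κ)]
  · have hm2 : 2 ≤ m := by omega
    have hc := diskMoment_antitone hκ hm2
    have hc0 := diskMoment_pos hκ m
    have h2' : diskMoment κ 2 ≤ 2 * (1 / κ) ^ 2 := by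
      rw [show (2 : ℕ) = 1 + 1 from rfl, diskMoment_succ, diskMoment_one]
      push_cast
      rw [div_mul_div_comm, div_pow, ← mul_div_assoc,
        div_le_div_iff₀ (by positivity) (by positivity)]
      nlinarith
    rw [sub_zero, abs_of_nonneg (by positivity)]
    have := div_le_self hc0.le h1
    nlinarith [sq_nonneg (1 / κ), mul_nonneg hB (sq_nonneg (1 / κ))]

end Eigenvalue

/-! ### Gamma asymptotics of the product of row sums -/

section Asymptotics

/-- This is a quotient of two Euler sequences for Γ without their end factors: `j = 0` accounts for
`a / b`, and `j = n` contributes a ratio tending to 1. -/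
theorem tendsto_rpow_mul_prod_div {a b : ℝ} (ha : 0 < a) (hb : 0 < b) :
    Tendsto (fun n : ℕ => (n : ℝ) ^ (a - b) *
      ∏ k ∈ Finset.range (n - 1), ((k : ℝ) + 1 + b) / ((k : ℝ) + 1 + a)) atTop
      (𝓝 (a / b * (Real.Gamma a / Real.Gamma b))) := by
  have hlin : Tendsto (fun n : ℕ => (a + n) / (b + n)) atTop (𝓝 1) := by
    have h1 : Tendsto (fun n : ℕ => 1 + (a - b) / (b + n)) atTop (𝓝 (1 + 0)) :=
      ((tendsto_atTop_add_const_left _ b tendsto_natCast_atTop_atTop).const_div_atTop _).const_add 1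
    rw [add_zero] at h1
    refine h1.congr fun n => ?_
    have : b + (n : ℝ) ≠ 0 := by positivity
    field_simp
    ring
  have hG := (((Real.GammaSeq_tendsto_Gamma a).div (Real.GammaSeq_tendsto_Gamma b)
    (Real.Gamma_pos_of_pos hb).ne').const_mul (a / b)).mul hlin
  rw [mul_one] at hG
  refine hG.congr' ?_
  filter_upwards [eventually_ge_atTop 1] with n hn
  obtain ⟨n, rfl⟩ := Nat.exists_eq_add_of_le' hn
  have hprod : ∀ c : ℝ, ∏ j ∈ Finset.range (n + 1 + 1), (c + j) =
      c * (∏ k ∈ Finset.range n, ((k : ℝ) + 1 + c)) * (c + ((n + 1 : ℕ) : ℝ)) := by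
    intro c
    rw [Finset.prod_range_succ, Finset.prod_range_succ']
    push_cast
    rw [add_zero, mul_comm c]
    congr 2
    exact Finset.prod_congr rfl fun k _ => by ring
  have hpos : ∀ c : ℝ, 0 < c → ∏ k ∈ Finset.range n, ((k : ℝ) + 1 + c) ≠ 0 := fun c hc =>
    Finset.prod_ne_zero_iff.2 fun k _ => by positivity
  have hpa := hpos a ha
  have hpb := hpos b hb
  have hN : (0 : ℝ) < ((n + 1 : ℕ) : ℝ) := by positivity
  simp only [Pi.div_apply, Real.GammaSeq, hprod, Nat.add_sub_cancel, Finset.prod_div_distrib]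
  rw [Real.rpow_sub hN]
  have h1 := (Real.rpow_pos_of_pos hN a).ne'
  have h2 := (Real.rpow_pos_of_pos hN b).ne'
  have h3 : a + ((n + 1 : ℕ) : ℝ) ≠ 0 := by positivity
  have h4 : b + ((n + 1 : ℕ) : ℝ) ≠ 0 := by positivity
  have h5 : ((n + 1)! : ℝ) ≠ 0 := by positivity
  field_simp

theorem prod_Icc_one_eq_prod_range (f : ℕ → ℝ) (r : ℕ) :
    ∏ p ∈ Finset.Icc 1 r, f p = ∏ p ∈ Finset.range r, f (p + 1) := by
  induction r with
  | zero => simp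
  | succ r ih => rw [Finset.prod_Icc_succ_top (by omega), ih, Finset.prod_range_succ]

/-- The binomial in the theorem cancels the factors `a / b` left by Euler's limit. -/
theorem choose_mul_prod_div (r s : ℕ) :
    ((s + r).choose r : ℝ) * ∏ p ∈ Finset.range r, ((p : ℝ) + 1) / (s + (p + 1)) = 1 := by
  induction r with
  | zero => simp
  | succ r ih =>
    have h : ((s + r : ℕ) + 1 : ℝ) * (s + r).choose r = (s + r + 1).choose (r + 1) * (r + 1) := by
      exact_mod_cast Nat.add_one_mul_choose_eq (s + r) r
    rw [Finset.prod_range_succ, ← add_assoc]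
    have hs : (s : ℝ) + (r + 1) ≠ 0 := by positivity
    calc _ = ((s + r + 1).choose (r + 1) * (r + 1) : ℝ) / (s + (r + 1)) *
          ∏ p ∈ Finset.range r, ((p : ℝ) + 1) / (s + (p + 1)) := by ring
      _ = ((s + r).choose r : ℝ) * ∏ p ∈ Finset.range r, ((p : ℝ) + 1) / (s + (p + 1)) := by
        rw [← h]
        congr 1
        push_cast
        field_simp
        ring
      _ = 1 := ih

theorem tendsto_prod_rowSum {β : ℝ} (hβ : 0 < β) {R r : ℕ} (hr : r ≤ R) :
    Tendsto (fun n : ℕ => (n : ℝ) ^ (-expo β R r) * (R.choose r : ℝ) *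
      ∏ k ∈ Finset.range (n - 1), rowSum (β * ((k : ℝ) + 1) / 2) r (R - r)) atTop
      (𝓝 (C β R r)) := by
  obtain ⟨s, rfl⟩ := Nat.exists_eq_add_of_le' hr
  rw [Nat.add_sub_cancel]
  -- With `κ = β (k + 1) / 2`, the `p`-th Chu–Vandermonde factor is `(k + 1 + b) / (k + 1 + a)` for
  -- these `a` and `b`.
  have hfac := tendsto_finsetProd (Finset.range r) fun p (_ : p ∈ Finset.range r) =>
    tendsto_rpow_mul_prod_div (a := 2 / β * (p + 1)) (b := 2 / β * (s + (p + 1)))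
      (by positivity) (by positivity)
  have hlim := hfac.const_mul ((s + r).choose r : ℝ)
  have hC : ((s + r).choose r : ℝ) * ∏ p ∈ Finset.range r,
      (2 / β * ((p : ℝ) + 1) / (2 / β * (s + (p + 1))) *
        (Real.Gamma (2 / β * (p + 1)) / Real.Gamma (2 / β * (s + (p + 1))))) =
      C β (s + r) r := by
    rw [Finset.prod_mul_distrib, ← mul_assoc]
    simp only [mul_div_mul_left _ _ (by positivity : 2 / β ≠ 0)]
    rw [choose_mul_prod_div, one_mul, C, prod_Icc_one_eq_prod_range]
    refine Finset.prod_congr rfl fun p _ => ?_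
    push_cast
    rw [add_sub_cancel_right]
  rw [hC] at hlim
  refine hlim.congr' ?_
  filter_upwards [eventually_ge_atTop 1] with n hn
  have hn0 : (0 : ℝ) < n := by exact_mod_cast hn
  have e1 : ∏ p ∈ Finset.range r, (n : ℝ) ^ (2 / β * ((p : ℝ) + 1) - 2 / β * (s + (p + 1))) =
      (n : ℝ) ^ (-expo β (s + r) r) := by
    rw [← Real.rpow_sum_of_pos hn0]
    congr 1
    have hp : ∀ p : ℕ, 2 / β * ((p : ℝ) + 1) - 2 / β * (s + (p + 1)) = -(2 / β * s) := fun p => by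
      ring
    simp only [hp]
    rw [Finset.sum_const, Finset.card_range, nsmul_eq_mul, expo]
    push_cast
    ring
  rw [Finset.prod_mul_distrib, e1, Finset.prod_comm, mul_left_comm, mul_assoc]
  congr 2
  refine Finset.prod_congr rfl fun k _ => ?_
  rw [rowSum_eq_prod r (by positivity)]
  refine Finset.prod_congr rfl fun p _ => ?_
  have : (k : ℝ) + 1 + 2 / β * (p + 1) ≠ 0 := by positivity
  have : β * ((k : ℝ) + 1) / 2 + (p + 1) ≠ 0 := by positivity
  field_simp
  ring

end Asymptotics

/-! ### The differential equation and the normalized step on `Gr R r` -/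

section Generator

variable {R r : ℕ}

/-- The weights `2 / β` on the edges of the graph with adjacency matrix `Δ`. -/
def edgeWeight (β : ℝ) (i j : Gr R r) : ℝ := 2 / β * if flips i.1 j.1 = 1 then 1 else 0

theorem edgeWeight_nonneg {β : ℝ} (hβ : 0 < β) (i j : Gr R r) : 0 ≤ edgeWeight β i j := by
  rw [edgeWeight]
  positivity

theorem edgeWeight_comm (β : ℝ) (i j : Gr R r) : edgeWeight β i j = edgeWeight β j i := by
  rw [edgeWeight, edgeWeight, flips_comm]

theorem sum_edgeWeight (β : ℝ) (hr : r ≤ R) (i : Gr R r) :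
    ∑ j, edgeWeight β i j = expo β R r := by
  simp only [edgeWeight]
  rw [← Finset.mul_sum, sum_flips_eq_one, Nat.cast_sub hr, expo]
  ring

/-- The diagonal of the potential `V` on `Gr R r`. -/
def potential (r : ℕ) (x : Fin R → ℂ) (i : Gr R r) : ℂ :=
  Complex.I / 2 * ∑ q, (-1 : ℂ) ^ ((i.1 q : ℕ) + 1) * x q

theorem prod_phase (x : Fin R → ℂ) (n : ℕ) (i : Gr R r) :
    ∏ q, phase (x q / n) (i.1 q) = Complex.exp (((n : ℝ)⁻¹ : ℝ) * potential r x i) := by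
  have h : ∀ (y : ℂ) (l : Fin 2),
      phase y l = Complex.exp (Complex.I / 2 * ((-1 : ℂ) ^ ((l : ℕ) + 1) * y)) := by
    intro y l
    fin_cases l
    · simp only [phase]; simp; ring_nf
    · simp only [phase]; simp; ring_nf
  simp only [h]
  rw [← Complex.exp_sum, potential, Finset.mul_sum, Finset.mul_sum]
  congr 1
  refine Finset.sum_congr rfl fun q _ => ?_
  push_cast
  ring

/-- The constant degree splits off as the scalar `expo / t`, which the substitution `Ψ = t ^ expo •
y` removes. -/
theorem generator_mulVec (β : ℝ) (hr : r ≤ R) (x : Fin R → ℂ) (t : ℝ) (u : Gr R r → ℂ) :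
    ((((2 / (β * t) : ℝ) : ℂ) • restrict r (Delta R) + restrict r (V x)).mulVec u) =
      (expo β R r / t) • u + (diagOp (potential r x) u - t⁻¹ • lapl (edgeWeight β) u) := by
  rw [Matrix.add_mulVec, Matrix.smul_mulVec]
  funext i
  have hV : (restrict r (V x)).mulVec u i = potential r x i * u i := by
    have : restrict r (V x) = Matrix.diagonal (potential r x) := by
      rw [restrict, V, Matrix.submatrix_diagonal _ _ Subtype.val_injective]
      rfl
    rw [this, Matrix.mulVec_diagonal]
  have hl : lapl (edgeWeight β) u i = expo β R r • u i -
      ((2 / β : ℝ) : ℂ) * (restrict r (Delta R)).mulVec u i := by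
    rw [lapl_apply, ← sum_edgeWeight β hr i, Finset.sum_smul, Matrix.mulVec, dotProduct,
      Finset.mul_sum, ← Finset.sum_sub_distrib]
    refine Finset.sum_congr rfl fun j _ => ?_
    rw [smul_sub, restrict_Delta_apply]
    congr 1
    rw [edgeWeight]
    split_ifs <;> simp
  simp only [Pi.add_apply, Pi.sub_apply, Pi.smul_apply, diagOp_apply, hV, hl, Complex.real_smul,
    smul_eq_mul]
  rw [show 2 / (β * t) = t⁻¹ * (2 / β) by rw [div_mul_eq_div_div, div_eq_inv_mul]]
  push_cast
  ring

theorem IsSolution.hasDerivAt_rpow_smul {β : ℝ} (hr : r ≤ R) {x : Fin R → ℂ}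
    {Ψ : ℝ → Gr R r → ℂ} (h : IsSolution β r x Ψ) {t : ℝ} (ht : 0 < t) :
    HasDerivAt (fun t : ℝ => t ^ (-expo β R r) • Ψ t)
      (diagOp (potential r x) (t ^ (-expo β R r) • Ψ t) -
        t⁻¹ • lapl (edgeWeight β) (t ^ (-expo β R r) • Ψ t)) t := by
  have h1 := h.ode t ht
  rw [generator_mulVec β hr] at h1
  refine ((Real.hasDerivAt_rpow_const (Or.inl ht.ne')).fun_smul h1).congr_deriv ?_
  rw [Real.rpow_sub_one ht.ne', map_smul, map_smul]
  module

theorem isSolution_rpow_smul {β : ℝ} (hr : r ≤ R) {x : Fin R → ℂ} {y y' : ℝ → Gr R r → ℂ} {K : ℝ}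
    (hy : ∀ t, HasDerivAt y (y' t) t)
    (hode : ∀ t, t • y' t + lapl (edgeWeight β) (y t) = t • diagOp (potential r x) (y t))
    (hye : ∀ t, 0 ≤ t → t ≤ 1 → ‖y t - fun _ => 1‖ ≤ K * t) :
    IsSolution β r x fun t => t ^ expo β R r • y t where
  ode t ht := by
    rw [generator_mulVec β hr]
    refine ((Real.hasDerivAt_rpow_const (Or.inl ht.ne')).fun_smul (hy t)).congr_deriv ?_
    have h1 : y' t = diagOp (potential r x) (y t) - t⁻¹ • lapl (edgeWeight β) (y t) := by
      have h2 := congrArg (fun z => t⁻¹ • z) (hode t)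
      simp only [smul_add, smul_smul, inv_mul_cancel₀ ht.ne', one_smul] at h2
      rw [← h2]; abel
    rw [h1, Real.rpow_sub_one ht.ne', map_smul, map_smul]
    module
  initial := by
    refine IsBigO.of_bound K ?_
    filter_upwards [Ioo_mem_nhdsGT (zero_lt_one (α := ℝ))] with t ht
    have e : ((t ^ (-expo β R r) : ℝ) : ℂ) • t ^ expo β R r • y t = y t := by
      rw [Complex.coe_smul, smul_smul, ← Real.rpow_add ht.1, neg_add_cancel, Real.rpow_zero,
        one_smul]
    rw [e, Real.norm_of_nonneg ht.1.le]
    exact hye t ht.1.le ht.2.le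

theorem IsSolution.eqOn {β : ℝ} (hβ : 0 < β) (hr : r ≤ R) {x : Fin R → ℂ}
    {Ψ Ψ' : ℝ → Gr R r → ℂ} (h : IsSolution β r x Ψ) (h' : IsSolution β r x Ψ') :
    Set.EqOn Ψ Ψ' (Set.Ioi 0) := by
  intro t ht
  set z : ℝ → Gr R r → ℂ := fun t => t ^ (-expo β R r) • Ψ t - t ^ (-expo β R r) • Ψ' t with hz
  have hd : ∀ t, 0 < t → HasDerivAt z
      (diagOp (potential r x) (z t) - t⁻¹ • lapl (edgeWeight β) (z t)) t := by
    intro t ht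
    refine ((h.hasDerivAt_rpow_smul hr ht).fun_sub (h'.hasDerivAt_rpow_smul hr ht)).congr_deriv ?_
    simp only [hz, map_sub, smul_sub]
    abel
  have hO : z =O[𝓝[>] (0 : ℝ)] fun t : ℝ => t := by
    refine (h.initial.sub h'.initial).congr_left fun t => ?_
    simp only [hz, Complex.coe_smul]
    abel
  have h0 := eq_zero_of_hasDerivAt_lapl (edgeWeight_nonneg hβ) (edgeWeight_comm β) _ hd hO ht
  have h1 : t ^ (-expo β R r) • Ψ t = t ^ (-expo β R r) • Ψ' t := sub_eq_zero.1 h0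
  exact smul_right_injective _ (Real.rpow_pos_of_pos ht _).ne' h1

/-- The transition probabilities of the normalized averaged transfer matrix. -/
def stepWeight (κ : ℝ) (i j : Gr R r) : ℝ := diskMoment κ (flips i.1 j.1) / rowSum κ r (R - r)

theorem sum_stepWeight {κ : ℝ} (hκ : 0 < κ) (i : Gr R r) : ∑ j, stepWeight κ i j = 1 := by
  simp only [stepWeight]
  rw [← Finset.sum_div, sum_comp_flips i (diskMoment κ), ← rowSum, div_self]
  linarith [one_le_rowSum hκ r (R - r)]

/-- The normalized averaged transfer matrix. -/
def stepOp (κ : ℝ) : (Gr R r → ℂ) →L[ℝ] (Gr R r → ℂ) :=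
  ContinuousLinearMap.id ℝ _ - lapl (stepWeight κ)

theorem stepOp_apply {κ : ℝ} (hκ : 0 < κ) (u : Gr R r → ℂ) (i : Gr R r) :
    stepOp κ u i = ∑ j, stepWeight κ i j • u j := by
  have h : stepOp κ u i = u i - lapl (stepWeight κ) u i := rfl
  rw [h, lapl_apply]
  simp only [smul_sub, Finset.sum_sub_distrib, ← Finset.sum_smul, sum_stepWeight hκ]
  simp

theorem norm_stepOp_le {κ : ℝ} (hκ : 0 < κ) (u : Gr R r → ℂ) : ‖stepOp κ u‖ ≤ ‖u‖ := by
  rw [pi_norm_le_iff_of_nonneg (norm_nonneg _)]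
  intro i
  have hnn : ∀ j : Gr R r, 0 ≤ stepWeight κ i j := fun j =>
    div_nonneg (diskMoment_pos hκ _).le (by linarith [one_le_rowSum hκ r (R - r)])
  rw [stepOp_apply hκ, ← one_mul ‖u‖, ← sum_stepWeight hκ i, Finset.sum_mul]
  refine norm_sum_le_of_le _ fun j _ => ?_
  rw [norm_smul, Real.norm_of_nonneg (hnn j)]
  exact mul_le_mul_of_nonneg_left (norm_le_pi_norm u j) (hnn j)

theorem stepOp_const (κ : ℝ) (c : ℂ) : stepOp κ (fun _ : Gr R r => c) = fun _ => c := by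
  have h : stepOp κ (fun _ : Gr R r => c) = (fun _ => c) - lapl (stepWeight κ) fun _ => c := rfl
  rw [h, lapl_const, sub_zero]

theorem exists_norm_stepOp_sub_le {β : ℝ} (hβ : 0 < β) (R r : ℕ) :
    ∃ L : ℝ, 0 ≤ L ∧ ∀ (k : ℕ) (u : Gr R r → ℂ),
      ‖stepOp (β * ((k : ℝ) + 1) / 2) u - u + ((k : ℝ) + 1)⁻¹ • lapl (edgeWeight β) u‖ ≤
        L / ((k : ℝ) + 1) ^ 2 * ‖u‖ := by
  obtain ⟨B, hB, h⟩ := exists_diskMoment_div_rowSum_sub_le r (R - r)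
  refine ⟨Fintype.card (Gr R r) * (2 * (B * (2 / β) ^ 2)), by positivity, fun k u => ?_⟩
  set κ := β * ((k : ℝ) + 1) / 2 with hκdef
  have hκ : 0 < κ := by positivity
  have hκinv : 1 / κ = ((k : ℝ) + 1)⁻¹ * (2 / β) := by
    rw [hκdef]; field_simp
  -- The error is itself a Laplacian, so diagonal weights are irrelevant and only pairs with at
  -- least one flip need an estimate.
  have e : stepOp κ u - u + ((k : ℝ) + 1)⁻¹ • lapl (edgeWeight β) u =
      lapl (fun i j => ((k : ℝ) + 1)⁻¹ * edgeWeight β i j - stepWeight κ i j) u := by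
    have h1 : stepOp κ u = u - lapl (stepWeight κ) u := rfl
    rw [h1]
    funext i
    simp only [Pi.add_apply, Pi.sub_apply, Pi.smul_apply, lapl_apply, Finset.smul_sum, smul_smul,
      sub_smul, Finset.sum_sub_distrib]
    ring
  rw [e]
  refine (norm_lapl_le (B := B * (1 / κ) ^ 2) (by positivity) (fun i j hij => ?_) u).trans
    (le_of_eq ?_)
  · rw [abs_sub_comm]
    have hm : 1 ≤ flips i.1 j.1 := Nat.one_le_iff_ne_zero.2 fun h0 => hij (eq_of_flips_eq_zero h0)
    have e2 : ((k : ℝ) + 1)⁻¹ * edgeWeight β i j = if flips i.1 j.1 = 1 then 1 / κ else 0 := by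
      rw [edgeWeight, ← mul_assoc, ← hκinv, mul_ite, mul_one, mul_zero]
    rw [e2]
    exact h κ hκ _ hm
  · rw [hκinv]
    field_simp

end Generator

end CircularBeta

end

/-! ### Assembly of the limit theorem -/

theorem propositionP {Ω : Type*} [MeasurableSpace Ω] (P : Measure Ω) [IsProbabilityMeasure P]
    (β : ℝ) (hβ : 0 < β) (R r : ℕ) (hr : r ≤ R) (x : Fin R → ℂ)
    (α : ℕ → Ω → ℂ)
    (hlaw : ∀ k : ℕ, HasLaw (α k) (CircularBeta.Theta (β * ((k : ℝ) + 1) + 1)) P)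
    (hindep : iIndepFun α P) :
    ∃ Ψ : ℝ → CircularBeta.Gr R r → ℂ,
      CircularBeta.IsSolution β r x Ψ ∧
      (∀ Ψ' : ℝ → CircularBeta.Gr R r → ℂ,
        CircularBeta.IsSolution β r x Ψ' → Set.EqOn Ψ' Ψ (Set.Ioi 0)) ∧
      ∀ i : CircularBeta.Gr R r,
        (∀ n : ℕ, 1 ≤ n → Integrable
          (fun ω => CircularBeta.vTensor (fun k => α k ω) (n - 1) (fun q => x q / n) i.1) P) ∧
        Tendsto
          (fun n : ℕ =>
            (((n : ℝ) ^ (-CircularBeta.expo β R r) : ℝ) : ℂ) * (R.choose r : ℂ) *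
              ∫ ω, CircularBeta.vTensor (fun k => α k ω) (n - 1) (fun q => x q / n) i.1 ∂P)
          atTop (𝓝 ((CircularBeta.C β R r : ℂ) * Ψ 1 i)) := by
  open CircularBeta in
  set e : Gr R r → ℂ := fun _ => 1 with he
  have hNe : lapl (edgeWeight β) e = 0 := lapl_const _ 1
  obtain ⟨y, y', K, hK, hy, hode, hye, hyb, hyt⟩ :=
    exists_regular_solution (lapl (edgeWeight β)) (diagOp (potential r x)) e hNe
      (le_norm_smul_add_lapl (edgeWeight_nonneg hβ))
  have hsol := isSolution_rpow_smul hr hy hode hye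
  refine ⟨_, hsol, fun Ψ' h' => h'.eqOn hβ hr hsol, ?_⟩
  set κ : ℕ → ℝ := fun k => β * ((k : ℝ) + 1) / 2 with hκdef
  have hκ : ∀ k, 0 < κ k := fun k => by positivity
  have hlaw' : ∀ k, HasLaw (α k) (Theta (2 * κ k + 1)) P := by
    intro k
    rw [show 2 * κ k = β * ((k : ℝ) + 1) by rw [hκdef]; ring]
    exact hlaw k
  set u : ℕ → ℕ → Gr R r → ℂ := fun n k i =>
    ∫ ω, vTensor (fun l => α l ω) k (fun q => x q / n) i.1 ∂P with hu
  -- Dividing the expectations by `Λ k` makes the averaged recursion a stochastic scheme; `Λ` itself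
  -- is handled by the Gamma asymptotics.
  set Λ : ℕ → ℝ := fun k => ∏ l ∈ Finset.range k, rowSum (κ l) r (R - r) with hΛ
  have hrow : ∀ k, rowSum (κ k) r (R - r) ≠ 0 := fun k => by
    linarith [one_le_rowSum (hκ k) r (R - r)]
  have hΛ0 : ∀ k, Λ k ≠ 0 := fun k => Finset.prod_ne_zero_iff.2 fun l _ => hrow l
  obtain ⟨L, hL, hstep⟩ := exists_norm_stepOp_sub_le hβ R r
  set L' := ‖potential r x‖ ^ 2 * Real.exp ‖potential r x‖ with hL'
  have hL'0 : 0 ≤ L' := by positivity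
  have hlim := tendsto_scheme hNe hK (L := L + L') (by positivity) hode hye hyb hyt
    (fun k => stepOp (κ k))
    (fun n => diagOp fun i => Complex.exp (((n : ℝ)⁻¹ : ℝ) * potential r x i))
    (fun k => norm_stepOp_le (hκ k)) (fun k => stepOp_const _ 1)
    (fun k w => (hstep k w).trans (by gcongr; linarith))
    (fun n hn w => (norm_diagOp_exp_sub_le _ (by positivity)
      (inv_le_one_of_one_le₀ (by exact_mod_cast hn)) w).trans (by gcongr; linarith))
    (fun n k => (Λ k)⁻¹ • u n k)
    (fun n => by
      funext i
      simp [hΛ, hu, he, vTensor, v_zero])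
    (fun n _ k => by
      funext i
      have h1 := integral_vTensor_succ hκ hlaw' hindep k (fun q => x q / n) i.1
      -- Balanced flips confine the sum over `G R` to `Gr R r`.
      simp only [flips_eq_flips_iff, ite_mul, zero_mul] at h1
      rw [← Finset.sum_filter, Finset.sum_subtype _ (fun j => by
        rw [Finset.mem_filter, and_iff_right (Finset.mem_univ j)])] at h1
      rw [Pi.smul_apply, hu]
      simp only
      rw [h1, stepOp_apply (hκ k), Finset.smul_sum]
      refine Finset.sum_congr rfl fun j _ => ?_
      rw [diagOp_apply, prod_phase, stepWeight, hΛ]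
      simp only [Pi.smul_apply, Complex.real_smul]
      rw [Finset.prod_range_succ]
      push_cast
      rw [mul_inv]
      ring)
  intro i
  refine ⟨fun n _ => integrable_vTensor hlaw' _ _ _, ?_⟩
  have h1 := ((Complex.continuous_ofReal.tendsto _).comp (tendsto_prod_rowSum hβ hr)).mul
    ((tendsto_pi_nhds.1 hlim) i)
  rw [Real.one_rpow, one_smul]
  refine h1.congr fun n => ?_
  have h2 : (Λ (n - 1) : ℂ) ≠ 0 := by exact_mod_cast hΛ0 _
  simp only [Function.comp_apply, Pi.smul_apply, Complex.real_smul, Complex.ofReal_mul,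
    Complex.ofReal_natCast, Complex.ofReal_inv]
  change (_ * _ * (Λ (n - 1) : ℂ)) * ((Λ (n - 1) : ℂ)⁻¹ * u n (n - 1) i) = _ * _ * u n (n - 1) i
  rw [mul_assoc, mul_inv_cancel_left₀ h2]
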